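/- Let $p_0$ be a probability distribution on $\mathbb{R}^d$, let $w:\mathbb{R}^d\to[0,\infty)$ be a measurable weight with $0<Z:=\int w\,\mathrm{d}p_0<\infty$, and let $q_0:=Z^{-1}w\,p_0$ be the tilted distribution. Assume that $\mathrm{supp}(q_0)\subseteq\{\mathbf{x}:\|\mathbf{x}\|_\infty\le 1\}$ and that there are constants $0<\underline{B}<1<\overline{B}<\infty$ with $\underline{B}\le w(\mathbf{x})\le\overline{B}$ for all $\mathbf{x}\in\mathrm{supp}(q_0)$. Let $0<t<T$. Let $(\mathbf{X}_s)_{0\le s\le T}$ be the Ornstein--Uhlenbeck process $\mathrm{d}\mathbf{X}_s=-\mathbf{X}_s\,\mathrm{d}s+\sqrt{2}\,\mathrm{d}\mathbf{B}_s$, $\mathbf{X}_0\sim p_0$, where $\mathbf{B}$ is a $d$-dimensional standard Brownian motion independent of $\mathbf{X}_0$, and let $\mathbf{X}^{\leftarrow}_s:=\mathbf{X}_{T-s}$ be its time reversal. For $s>0$ write $p_s$ for the density of $\mathbf{X}_s$, that is, $p_s(\mathbf{x})=\int\varphi_d(\mathbf{x};e^{-s}\mathbf{x}_0,(1-e^{-2s})\mathbf{I}_d)\,p_0(\mathrm{d}\mathbf{x}_0)$,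 where $\varphi_d(\cdot;\mathbf{m},v\mathbf{I}_d)$ is the density of $\mathcal{N}(\mathbf{m},v\mathbf{I}_d)$. Doob's $h$-function is $$h_t^*(\mathbf{x}):=\mathbb{E}\big[w(\mathbf{X}_T^{\leftarrow})\,\big|\,\mathbf{X}_t^{\leftarrow}=\mathbf{x}\big].$$ Let $H^1(p_{T-t})$ be the space of $f\in L^2(p_{T-t})$ that have a weak gradient $\nabla f\in L^2(p_{T-t})$, and $H^2(p_{T-t})$ the space of $f\in H^1(p_{T-t})$ with $\partial_k f\in H^1(p_{T-t})$ for $k=1,\dots,d$. All derivatives of elements of these spaces below are weak derivatives. Then $h_t^*\in H^2(p_{T-t})$ and $\Delta h_t^*+\nabla h_t^*\cdot\nabla\log p_{T-t}\in L^2(p_{T-t})$. Moreover, for every $\lambda>0$ and every minimizer $h_t^\lambda$ over $H^1(p_{T-t})$ of the gradient-regularized objective $$\mathcal{J}_t^\lambda(h):=\mathbb{E}\big[|h(\mathbf{X}_t^{\leftarrow})-w(\mathbf{X}_T^{\leftarrow})|^2\big]+\lambda\,\mathbb{E}\big[\|\nabla h(\mathbf{X}_t^{\leftarrow})\|_2^2\big],$$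 one has $$\|h_t^\lambda-h_t^*\|_{L^2(p_{T-t})}^2\le\lambda^2\,\|\Delta h_t^*+\nabla h_t^*\cdot\nabla\log p_{T-t}\|_{L^2(p_{T-t})}^2,$$ $$\|\nabla h_t^\lambda-\nabla h_t^*\|_{L^2(p_{T-t})}^2\le\lambda\,\|\Delta h_t^*+\nabla h_t^*\cdot\nabla\log p_{T-t}\|_{L^2(p_{T-t})}^2.$$ -/

import Mathlib

open MeasureTheory ProbabilityTheory
open scoped NNReal ENNReal InnerProductSpace

noncomputable section

namespace DoobMatching

/-- The Euclidean space `ℝ^d` with its Euclidean norm. -/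
abbrev E (d : ℕ) : Type := EuclideanSpace ℝ (Fin d)

/-! ### Weighted Sobolev spaces through weak derivatives -/

/-- `G` is a weak (distributional) gradient of `f` on `ℝ^d`: both are locally integrable and
`∫ f ∂ₖφ dx = - ∫ Gₖ φ dx` for every test function `φ ∈ C_c^∞(ℝ^d)` and every coordinate `k`. -/
structure HasWeakGradient {d : ℕ} (f : E d → ℝ) (G : E d → E d) : Prop where
  locallyIntegrable : LocallyIntegrable f volume
  locallyIntegrable_grad : LocallyIntegrable G volume
  integral_eq : ∀ φ : E d → ℝ, ContDiff ℝ (⊤ : ℕ∞) φ → HasCompactSupport φ → ∀ k : Fin d,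
    ∫ x, f x * fderiv ℝ φ x (EuclideanSpace.single k 1) = - ∫ x, G x k * φ x

open Classical in
/-- The weak gradient `∇f`, determined up to Lebesgue-null sets
(the zero field if `f` has no weak gradient). -/
def weakGrad {d : ℕ} (f : E d → ℝ) : E d → E d :=
  if h : ∃ G : E d → E d, HasWeakGradient f G then h.choose else 0

theorem HasWeakGradient.weakGrad {d : ℕ} {f : E d → ℝ} {G : E d → E d}
    (h : HasWeakGradient f G) : HasWeakGradient f (weakGrad f) := by
  have hex : ∃ G : E d → E d, HasWeakGradient f G := ⟨G, h⟩
  rw [DoobMatching.weakGrad, dif_pos hex]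
  exact hex.choose_spec

/-- The weak Laplacian `Δf = ∑ₖ ∂ₖ(∂ₖf)`. -/
def weakLaplacian {d : ℕ} (f : E d → ℝ) (x : E d) : ℝ :=
  ∑ k : Fin d, weakGrad (fun y => weakGrad f y k) x k

/-- The weighted Sobolev space `H¹(ν)`: `f ∈ L²(ν)` is weakly differentiable with
`∇f ∈ L²(ν)`. -/
structure MemH1 {d : ℕ} (ν : Measure (E d)) (f : E d → ℝ) : Prop where
  memLp : MemLp f 2 ν
  exists_weakGradient : ∃ G : E d → E d, HasWeakGradient f G
  memLp_weakGrad : MemLp (weakGrad f) 2 ν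

/-- The weighted Sobolev space `H²(ν)`: `f ∈ H¹(ν)` and every `∂ₖf ∈ H¹(ν)`. -/
structure MemH2 {d : ℕ} (ν : Measure (E d)) (f : E d → ℝ) : Prop where
  memH1 : MemH1 ν f
  memH1_partial : ∀ k : Fin d, MemH1 ν (fun x => weakGrad f x k)

/-! ### The reference diffusion -/

/-- `X` solves `dX_t = -X_t dt + √2 dB_t` on `[0, T]` with `X_0 ∼ p₀`, for some `d`-dimensional
standard Brownian motion `B` (independent standard real Brownian motions as coordinates)
that is independent of `X_0`. -/
structure IsForwardOU {d : ℕ} {Ω : Type*} [MeasurableSpace Ω] (P : Measure Ω)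
    (p₀ : Measure (E d)) (T : ℝ) (X : ℝ → Ω → E d) : Prop where
  measurable : ∀ t ∈ Set.Icc 0 T, Measurable (X t)
  map_zero : P.map (X 0) = p₀
  continuousOn : ∀ᵐ ω ∂P, ContinuousOn (fun t => X t ω) (Set.Icc 0 T)
  sde : ∃ B : Fin d → ℝ≥0 → Ω → ℝ,
    (∀ i t, Measurable (B i t)) ∧
    (∀ i, IsBrownianReal (B i) P) ∧
    iIndepFun (fun i ω t => B i t ω) P ∧
    IndepFun (X 0) (fun ω i t => B i t ω) P ∧
    ∀ᵐ ω ∂P, ∀ t ∈ Set.Icc 0 T, ∀ i : Fin d,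
      X t ω i = X 0 ω i - (∫ s in (0 : ℝ)..t, X s ω i) + √2 * B i t.toNNReal ω

/-- The time reversal `X^←_t = X_{T-t}` of a process on `[0, T]`. -/
def timeReversal {d : ℕ} {Ω : Type*} (T : ℝ) (X : ℝ → Ω → E d) (t : ℝ) : Ω → E d :=
  X (T - t)

/-- The mean coefficient `μ_t = exp (-t)`. -/
def meanCoeff (t : ℝ) : ℝ := Real.exp (-t)

/-- The variance `σ_t² = 1 - exp (-2t)`. -/
def varCoeff (t : ℝ) : ℝ := 1 - Real.exp (-2 * t)

/-- The density at `x` of the Gaussian distribution `N(m, v I_d)` on `ℝ^d`, for `v > 0`. -/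
def gaussianDensity {d : ℕ} (m : E d) (v : ℝ) (x : E d) : ℝ :=
  (2 * Real.pi * v) ^ (-(d : ℝ) / 2) * Real.exp (-‖x - m‖ ^ 2 / (2 * v))

/-- The marginal density `p_t(x) = ∫ φ_d(x; μ_t x₀, σ_t² I_d) p₀(dx₀)`, for `t > 0`. -/
def marginalDensity {d : ℕ} (p₀ : Measure (E d)) (t : ℝ) (x : E d) : ℝ :=
  ∫ x₀, gaussianDensity (meanCoeff t • x₀) (varCoeff t) x ∂p₀

/-- The measure `p_t(x) dx`. -/
def marginal {d : ℕ} (p₀ : Measure (E d)) (t : ℝ) : Measure (E d) :=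
  volume.withDensity (fun x => ENNReal.ofReal (marginalDensity p₀ t x))

/-- The score `∇ log p_t`. -/
def score {d : ℕ} (p₀ : Measure (E d)) (t : ℝ) : E d → E d :=
  gradient (fun x => Real.log (marginalDensity p₀ t x))

/-- The tilted distribution `q₀(dx) = w(x) p₀(dx) / Z` with `Z = ∫ w dp₀`. -/
def tilted {d : ℕ} (p₀ : Measure (E d)) (w : E d → ℝ) : Measure (E d) :=
  p₀.withDensity (fun x => ENNReal.ofReal (w x / ∫ y, w y ∂p₀))

/-! ### Doob's `h`-function and the gradient-regularized objective

In this section `Y` stands for the time-reversed process `X^←`. -/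

/-- Doob's `h`-function `h*(t, x) = 𝔼[w(Y_T) | Y_t = x]`, the integral of `w` against the regular
conditional distribution of `Y_T` given `Y_t = x`. -/
def doobH {d : ℕ} {Ω : Type*} [MeasurableSpace Ω] (P : Measure Ω) [IsFiniteMeasure P]
    (Y : ℝ → Ω → E d) (w : E d → ℝ) (T t : ℝ) (x : E d) : ℝ :=
  ∫ y, w y ∂(condDistrib (Y T) (Y t) P x)

/-- The implicit objective `J_t(h) = 𝔼[(h(Y_t) - w(Y_T))²]`. -/
def objective {d : ℕ} {Ω : Type*} [MeasurableSpace Ω] (P : Measure Ω)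
    (Y : ℝ → Ω → E d) (w : E d → ℝ) (T t : ℝ) (h : E d → ℝ) : ℝ :=
  ∫ ω, (h (Y t ω) - w (Y T ω)) ^ 2 ∂P

/-- The gradient-regularized objective `J_t^λ(h) = J_t(h) + λ 𝔼[‖∇h(Y_t)‖²]`. -/
def regObjective {d : ℕ} {Ω : Type*} [MeasurableSpace Ω] (P : Measure Ω)
    (Y : ℝ → Ω → E d) (w : E d → ℝ) (T t lam : ℝ) (h : E d → ℝ) : ℝ :=
  objective P Y w T t h + lam * ∫ ω, ‖weakGrad h (Y t ω)‖ ^ 2 ∂P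

/-- `hlam` minimizes the gradient-regularized objective over `H¹(ν)`. -/
def IsRegMinimizer {d : ℕ} {Ω : Type*} [MeasurableSpace Ω] (P : Measure Ω)
    (Y : ℝ → Ω → E d) (w : E d → ℝ) (T t lam : ℝ) (ν : Measure (E d)) (hlam : E d → ℝ) : Prop :=
  MemH1 ν hlam ∧
    ∀ h : E d → ℝ, MemH1 ν h →
      regObjective P Y w T t lam hlam ≤ regObjective P Y w T t lam h

end DoobMatching

end

/-! Put `s = T - t`, let `p` be the density of `X_s`, and let `L = Δ + ∇log p · ∇`. Integrating by
parts against the weight `p` gives `∫ ∇g·∇u p = -∫ g (Lu) p`. The minimizer `H` satisfies the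
Euler–Lagrange equation `E[(H - w)g] + λ E[∇H·∇g] = 0` for every `g` in `H¹`. Since `h*` is a
conditional expectation, `w` may be replaced by `h*` in the first term. With `g = H - h*` and `∇H =
∇g + ∇h*` this becomes `‖g‖² + λ‖∇g‖² = λ⟨g, Lh*⟩`. The inequality `2λ⟨g, Lh*⟩ ≤ ‖g‖² + λ²‖Lh*‖²`
then gives `‖g‖² + 2λ‖∇g‖² ≤ λ²‖Lh*‖²`, which contains both bounds (`IsRegMinimizer.first_order`,
`integral_inner_weakGrad_gradient`, `error_bounds_of_first_order`).

The remaining work is regularity. Almost everywhere, `h*` is a quotient of two Gaussian smoothings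
of bounded functions, hence smooth. Each derivative brings down a polynomial factor, so derivatives
of `h*` and of `log p` are polynomial expressions in conditional expectations of polynomials of the
Gaussian noise. Jensen's inequality bounds every `L^q` norm of these by Gaussian moments
(`IsBddMeas.tame_ratio`), with no moment condition on `p₀`.

The quotient formula needs the joint law of `(X_0, X_s)`. It is read off the integral equation path
by path: `e^s X_s - X_0` is a limit of Riemann sums against Brownian increments, whose
characteristic functions are explicit (`IsForwardOU.map_prodMk_sub`). -/

namespace DoobMatching

open Filter Topology

/-! ### Riemann sums against Brownian increments, without stochastic integration. -/

section WienerSum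

lemma charFun_weighted_increments {Ω : Type*} [MeasurableSpace Ω] {P : Measure Ω}
    {B : ℝ≥0 → Ω → ℝ} (hB : IsPreBrownianReal B P) {τ : ℕ → ℝ≥0} (hτ : Monotone τ)
    (c : ℕ → ℝ) (n : ℕ) (u : ℝ) :
    charFun (P.map fun ω => ∑ k ∈ Finset.range n, c k * (B (τ (k + 1)) ω - B (τ k) ω)) u
      = Complex.exp (-((∑ k ∈ Finset.range n, c k ^ 2 * ((τ (k + 1) : ℝ) - τ k) : ℝ) : ℂ)
          * u ^ 2 / 2) := by
  have hP : IsProbabilityMeasure P := hB.isGaussianProcess.isProbabilityMeasure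
  have hmeas : ∀ t, AEMeasurable (B t) P := hB.aemeasurable
  have hind : iIndepFun (fun k ω => c k * (B (τ (k + 1)) ω - B (τ k) ω)) P :=
    (hB.hasIndepIncrements.nat hτ).comp (fun k x => c k * x) (fun k => by fun_prop)
  rw [(hind.restrict (Finset.range n)).charFun_map_fun_finsetSum_eq_prod (fun i _ => by fun_prop)]
  rw [Finset.prod_apply]
  have h1 : ∀ k, charFun (P.map fun ω => c k * (B (τ (k + 1)) ω - B (τ k) ω)) u
      = Complex.exp (-((c k ^ 2 * ((τ (k + 1) : ℝ) - τ k) : ℝ) : ℂ) * u ^ 2 / 2) := by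
    intro k
    have h2 := (hB.hasLaw_sub (τ (k + 1)) (τ k)).map_eq
    have h3 : charFun (P.map fun ω => c k * (B (τ (k + 1)) ω - B (τ k) ω)) u
        = charFun (P.map (B (τ (k + 1)) - B (τ k))) (c k * u) := by
      rw [← charFun_map_mul, AEMeasurable.map_map_of_aemeasurable (by fun_prop) (by fun_prop)]
      rfl
    rw [h3, h2, charFun_gaussianReal]
    have h4 : ((nndist (τ (k + 1) : ℝ) (τ k) : ℝ≥0) : ℝ) = (τ (k + 1) : ℝ) - τ k := by
      rw [coe_nndist, Real.dist_eq, abs_of_nonneg]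
      exact sub_nonneg.2 (NNReal.coe_le_coe.2 (hτ (Nat.le_succ k)))
    have h5 : (((nndist (τ (k + 1) : ℝ) (τ k) : ℝ≥0) : ℝ) : ℂ)
      = (((τ (k + 1) : ℝ) - τ k : ℝ) : ℂ) := by rw [h4]
    congr 1
    erw [h5]
    push_cast
    ring
  simp_rw [h1]
  rw [← Complex.exp_sum]
  congr 1
  push_cast
  rw [← Finset.sum_neg_distrib, Finset.sum_mul, Finset.sum_div]

/-- These are left Riemann sums of `∫₀ˢ e^{2r} dr`, the variance of the limiting noise up to a
factor. The geometric series sums them in closed form, and its denominator is a difference quotient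
of `x ↦ e^{2sx}` at `0` with step `1/(n+1)`. -/
lemma tendsto_exp_riemann_sum (s : ℝ) (hs : 0 < s) :
    Tendsto (fun n : ℕ => ∑ k ∈ Finset.range (n + 1),
        Real.exp (s * k / (n + 1 : ℕ)) ^ 2 * (s / (n + 1 : ℕ))) atTop
      (𝓝 ((Real.exp (2 * s) - 1) / 2)) := by
  have key : ∀ n : ℕ, ∑ k ∈ Finset.range (n + 1),
        Real.exp (s * k / (n + 1 : ℕ)) ^ 2 * (s / (n + 1 : ℕ))
      = (Real.exp (2 * s) - 1) * s
        / (((n + 1 : ℕ) : ℝ) * (Real.exp (2 * s / (n + 1 : ℕ)) - 1)) := by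
    intro n
    have hn : (0 : ℝ) < (n + 1 : ℕ) := by positivity
    have hq : Real.exp (2 * s / (n + 1 : ℕ)) ≠ 1 := by
      rw [Ne, Real.exp_eq_one_iff]; positivity
    have h1 : ∀ k : ℕ, Real.exp (s * k / (n + 1 : ℕ)) ^ 2
        = Real.exp (2 * s / (n + 1 : ℕ)) ^ k := by
      intro k
      rw [← Real.exp_nat_mul, ← Real.exp_nat_mul]
      congr 1; push_cast; ring
    rw [← Finset.sum_mul]
    simp_rw [h1]
    rw [geom_sum_eq hq, ← Real.exp_nat_mul]
    have h2 : ((n + 1 : ℕ) : ℝ) * (2 * s / (n + 1 : ℕ)) = 2 * s := by field_simp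
    rw [h2]
    have := sub_ne_zero.2 hq
    field_simp
  simp_rw [key]
  have h0 : Tendsto (fun n : ℕ => ((n + 1 : ℕ) : ℝ) * (Real.exp (2 * s / (n + 1 : ℕ)) - 1)) atTop
      (𝓝 (2 * s)) := by
    have hd : HasDerivAt (fun x : ℝ => Real.exp (2 * s * x)) (2 * s) 0 := by
      have := ((hasDerivAt_id (0 : ℝ)).const_mul (2 * s)).exp
      simpa using this
    rw [hasDerivAt_iff_tendsto_slope] at hd
    have hseq : Tendsto (fun n : ℕ => 1 / ((n : ℝ) + 1)) atTop (𝓝[≠] 0) := by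
      rw [tendsto_nhdsWithin_iff]
      exact ⟨tendsto_one_div_add_atTop_nhds_zero_nat, Eventually.of_forall fun n => by
        simp only [Set.mem_compl_iff, Set.mem_singleton_iff]; positivity⟩
    refine (hd.comp hseq).congr fun n => ?_
    simp only [Function.comp, slope, vsub_eq_sub, smul_eq_mul, mul_zero, Real.exp_zero, sub_zero,
      Nat.cast_add, Nat.cast_one, one_div, inv_inv]
    rw [div_eq_mul_inv]
  have := (tendsto_const_nhds (x := (Real.exp (2 * s) - 1) * s)).div h0 (by positivity)
  refine this.congr' ?_ |>.trans (le_of_eq ?_)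
  · exact Eventually.of_forall fun n => rfl
  · congr 1; field_simp

/-- One-step error of the discrete product rule for `e^r x_r`: it equals `∫ (e^r x_b - e^a x_r) dr`
over `[a, b]`, which is small when the integrand is. -/
lemma norm_integral_sub_le_of_dist_lt {x : ℝ → ℝ} {s a b ε : ℝ} (ha : 0 ≤ a)
    (hab : a ≤ b) (hbs : b ≤ s) (hx : ContinuousOn x (Set.Icc 0 s))
    (hε : ∀ p ∈ Set.Icc a b, |Real.exp p * x b - Real.exp a * x p| ≤ ε) :
    |(Real.exp b - Real.exp a) * x b - Real.exp a * ∫ r in a..b, x r| ≤ ε * (b - a) := by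
  have hx' : ContinuousOn x (Set.uIcc a b) := by
    rw [Set.uIcc_of_le hab]
    exact hx.mono fun p hp => ⟨ha.trans hp.1, hp.2.trans hbs⟩
  have h1 : (Real.exp b - Real.exp a) * x b - Real.exp a * ∫ r in a..b, x r
      = ∫ r in a..b, (Real.exp r * x b - Real.exp a * x r) := by
    rw [intervalIntegral.integral_sub, intervalIntegral.integral_mul_const, integral_exp,
      intervalIntegral.integral_const_mul]
    · exact (Real.continuous_exp.mul continuous_const).intervalIntegrable _ _
    · exact (continuousOn_const.mul hx').intervalIntegrable
  rw [h1, ← Real.norm_eq_abs]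
  refine (intervalIntegral.norm_integral_le_of_norm_le_const (C := ε) fun p hp => ?_).trans ?_
  · rw [Set.uIoc_of_le hab] at hp
    exact hε p ⟨hp.1.le, hp.2⟩
  · rw [abs_of_nonneg (sub_nonneg.2 hab)]

/-- Formally `d(e^r x_r) = √2 e^r db_r`. The weight is smooth and the path `x` is continuous, so
this holds for each path as a limit of sums; no property of `b` beyond the equation enters. -/
lemma tendsto_weighted_increments {x b : ℝ → ℝ} {s : ℝ} (hs : 0 < s)
    (hx : ContinuousOn x (Set.Icc 0 s))
    (hxb : ∀ t ∈ Set.Icc 0 s, x t = x 0 - (∫ r in (0 : ℝ)..t, x r) + √2 * b t) :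
    Tendsto (fun n : ℕ => √2 * ∑ k ∈ Finset.range (n + 1), Real.exp (s * k / (n + 1 : ℕ))
        * (b (s * (k + 1 : ℕ) / (n + 1 : ℕ)) - b (s * k / (n + 1 : ℕ)))) atTop
      (𝓝 (Real.exp s * x s - x 0)) := by
  have hF : ContinuousOn (fun q : ℝ × ℝ => Real.exp q.1 * x q.2)
      (Set.Icc 0 s ×ˢ Set.Icc 0 s) := by
    refine (Real.continuous_exp.comp continuous_fst).continuousOn.mul ?_
    exact hx.comp continuous_snd.continuousOn fun q hq => hq.2
  have hunif := (isCompact_Icc.prod isCompact_Icc).uniformContinuousOn_of_continuous hF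
  rw [Metric.uniformContinuousOn_iff_le] at hunif
  rw [Metric.tendsto_atTop]
  intro ε hε
  -- With tolerance `ε / (2s)` per unit of time, the errors over `[0, s]` add up to at most `ε / 2`.
  obtain ⟨δ, hδ, hδF⟩ := hunif (ε / (2 * s)) (by positivity)
  obtain ⟨N, hN⟩ := exists_nat_gt (s / δ)
  refine ⟨N, fun n hn => ?_⟩
  set m : ℝ := ((n + 1 : ℕ) : ℝ) with hm
  have hmpos : 0 < m := by positivity
  have hmesh : s / m ≤ δ := by
    rw [div_le_iff₀ hmpos]
    rw [div_lt_iff₀ hδ] at hN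
    have : (N : ℝ) ≤ m := by rw [hm]; exact_mod_cast hn.trans (Nat.le_succ n)
    nlinarith
  set r : ℕ → ℝ := fun k => s * k / m with hr
  have hr0 : ∀ k, 0 ≤ r k := fun k => by positivity
  have hrs : ∀ k, k ≤ n + 1 → r k ≤ s := by
    intro k hk
    rw [hr]
    simp only
    rw [div_le_iff₀ hmpos]
    have : (k : ℝ) ≤ m := by rw [hm]; exact_mod_cast hk
    nlinarith
  have hstep : ∀ k, r (k + 1) - r k = s / m := by
    intro k; simp only [hr]; push_cast; ring
  have hterm : ∀ k ∈ Finset.range (n + 1),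
      |(Real.exp (r (k + 1)) * x (r (k + 1)) - Real.exp (r k) * x (r k))
        - √2 * (Real.exp (r k) * (b (r (k + 1)) - b (r k)))| ≤ ε / (2 * s) * (s / m) := by
    intro k hk
    have hk' : k + 1 ≤ n + 1 := Finset.mem_range.1 hk
    have hle : r k ≤ r (k + 1) := by
      have := hstep k
      have : 0 < s / m := by positivity
      linarith
    have h1 := norm_integral_sub_le_of_dist_lt (x := x) (s := s) (ε := ε / (2 * s)) (hr0 k) hle
      (hrs _ hk') hx ?_
    · rw [hstep] at h1
      refine le_trans (le_of_eq ?_) h1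
      congr 1
      have e1 := hxb (r k) ⟨hr0 k, hrs _ (by omega)⟩
      have e2 := hxb (r (k + 1)) ⟨hr0 _, hrs _ hk'⟩
      have hint : ∀ p q, p ∈ Set.Icc 0 s → q ∈ Set.Icc 0 s → IntervalIntegrable x volume p q := by
        intro p q hp hq
        refine (hx.mono ?_).intervalIntegrable
        exact Set.OrdConnected.uIcc_subset Set.ordConnected_Icc hp hq
      have hz : (0 : ℝ) ∈ Set.Icc 0 s := ⟨le_rfl, hs.le⟩
      have e3 := intervalIntegral.integral_add_adjacent_intervals
        (hint 0 (r k) hz ⟨hr0 k, hrs _ (by omega)⟩)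
        (hint (r k) (r (k + 1)) ⟨hr0 k, hrs _ (by omega)⟩ ⟨hr0 _, hrs _ hk'⟩)
      -- The integral equation is subtracted at two consecutive nodes to eliminate the driving path.
      have e4 : √2 * (b (r (k + 1)) - b (r k))
          = x (r (k + 1)) - x (r k) + ∫ q in (r k)..(r (k + 1)), x q := by linarith
      have e5 : √2 * (Real.exp (r k) * (b (r (k + 1)) - b (r k)))
        = Real.exp (r k) * (√2 * (b (r (k + 1)) - b (r k))) := by ring
      rw [e5, e4]
      ring
    · intro p hp
      have hp0 : p ∈ Set.Icc 0 s := ⟨(hr0 k).trans hp.1, hp.2.trans (hrs _ hk')⟩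
      have := hδF (p, r (k + 1)) ⟨hp0, hr0 _, hrs _ hk'⟩ (r k, p)
        ⟨⟨hr0 _, hrs _ (by omega)⟩, hp0⟩ ?_
      · simpa [Real.dist_eq] using this
      · rw [Prod.dist_eq, max_le_iff]
        have := hstep k
        simp only [Real.dist_eq]
        constructor <;> rw [abs_le] <;> constructor <;> linarith [hp.1, hp.2]
  have htel : Real.exp s * x s - x 0
      = ∑ k ∈ Finset.range (n + 1),
        (Real.exp (r (k + 1)) * x (r (k + 1)) - Real.exp (r k) * x (r k)) := by
    rw [Finset.sum_range_sub (fun k => Real.exp (r k) * x (r k))]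
    have e1 : r (n + 1) = s := by
      simp only [hr, ← hm]; field_simp
    have e2 : r 0 = 0 := by simp [hr]
    rw [e1, e2]; simp
  rw [dist_comm, Real.dist_eq, htel, Finset.mul_sum, ← Finset.sum_sub_distrib]
  refine (Finset.abs_sum_le_sum_abs _ _).trans_lt ?_
  refine (Finset.sum_le_sum hterm).trans_lt ?_
  rw [Finset.sum_const, Finset.card_range, nsmul_eq_mul, ← hm]
  have : m * (ε / (2 * s) * (s / m)) = ε / 2 := by field_simp
  rw [this]
  linarith

end WienerSum

/-! ### The isotropic Gaussian density and its Fourier transform. -/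

section Gaussian

variable {d : ℕ}

lemma continuous_gaussianDensity (m : E d) (v : ℝ) : Continuous (gaussianDensity m v) := by
  unfold gaussianDensity; fun_prop

lemma gaussianDensity_pos {v : ℝ} (hv : 0 < v) (m x : E d) : 0 < gaussianDensity m v x := by
  unfold gaussianDensity; positivity

lemma gaussianDensity_eq_sub (m : E d) (v : ℝ) (x : E d) :
    gaussianDensity m v x = gaussianDensity 0 v (x - m) := by
  simp [gaussianDensity]

/-- The centered Gaussian distribution `N(0, v I_d)`. -/
noncomputable def centeredGaussian (d : ℕ) (v : ℝ) : Measure (E d) :=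
  volume.withDensity fun z => ENNReal.ofReal (gaussianDensity 0 v z)

lemma integral_centeredGaussian {F : Type*} [NormedAddCommGroup F] [NormedSpace ℝ F]
    {v : ℝ} (hv : 0 < v) (f : E d → F) :
    ∫ z, f z ∂centeredGaussian d v = ∫ z, gaussianDensity 0 v z • f z := by
  rw [centeredGaussian, integral_withDensity_eq_integral_toReal_smul]
  · refine integral_congr_ae (Eventually.of_forall fun z => ?_)
    simp only [ENNReal.toReal_ofReal (gaussianDensity_pos hv 0 z).le]
  · exact ((continuous_gaussianDensity 0 v).measurable).ennreal_ofReal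
  · exact Eventually.of_forall fun z => ENNReal.ofReal_lt_top

lemma charFun_centeredGaussian {v : ℝ} (hv : 0 < v) (u : E d) :
    charFun (centeredGaussian d v) u = Complex.exp (-(v : ℂ) * (‖u‖ : ℂ) ^ 2 / 2) := by
  rw [charFun_apply, integral_centeredGaussian hv]
  have hb : 0 < ((1 / (2 * v) : ℝ) : ℂ).re := by rw [Complex.ofReal_re]; positivity
  have h := GaussianFourier.integral_cexp_neg_mul_sq_norm_add (V := E d) hb Complex.I u
  have h1 : ∀ z : E d, gaussianDensity 0 v z • Complex.exp (⟪z, u⟫_ℝ * Complex.I)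
      = (((2 * Real.pi * v) ^ (-(d : ℝ) / 2) : ℝ) : ℂ)
        * Complex.exp (-((1 / (2 * v) : ℝ) : ℂ) * (‖z‖ : ℂ) ^ 2 + Complex.I * ⟪u, z⟫_ℝ) := by
    intro z
    rw [Complex.exp_add, gaussianDensity, Complex.real_smul, sub_zero, Complex.ofReal_mul,
      Complex.ofReal_exp, mul_assoc, real_inner_comm u z]
    congr 3
    · push_cast; ring
    · ring
  simp_rw [h1]
  rw [integral_const_mul, h]
  have h2 : ((Real.pi : ℂ) / ((1 / (2 * v) : ℝ) : ℂ)) ^ ((Module.finrank ℝ (E d) : ℂ) / 2)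
      = (((2 * Real.pi * v) ^ ((d : ℝ) / 2) : ℝ) : ℂ) := by
    rw [Complex.ofReal_cpow (by positivity)]
    congr 1
    · push_cast; field_simp
    · simp
  rw [h2, ← mul_assoc, ← Complex.ofReal_mul, ← Real.rpow_add (by positivity)]
  have h3 : -(d : ℝ) / 2 + (d : ℝ) / 2 = 0 := by ring
  rw [h3, Real.rpow_zero, Complex.ofReal_one, one_mul, Complex.I_sq]
  congr 1
  have : (v : ℂ) ≠ 0 := by exact_mod_cast hv.ne'
  push_cast
  field_simp
  ring

lemma integrable_gaussianDensity {v : ℝ} (hv : 0 < v) (m : E d) :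
    Integrable (gaussianDensity m v) := by
  have hb : 0 < ((1 / (2 * v) : ℝ) : ℂ).re := by rw [Complex.ofReal_re]; positivity
  have h := GaussianFourier.integrable_cexp_neg_mul_sq_norm_add (V := E d) hb 0 0
  have h0 : Integrable (gaussianDensity (0 : E d) v) := by
    refine (h.norm.const_mul ((2 * Real.pi * v) ^ (-(d : ℝ) / 2))).congr
      (Eventually.of_forall fun z => ?_)
    simp only [gaussianDensity, sub_zero]
    rw [Complex.norm_exp]
    congr 2
    simp only [zero_mul, add_zero]
    rw [← Complex.ofReal_pow, ← Complex.ofReal_neg, ← Complex.ofReal_mul, Complex.ofReal_re]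
    field_simp
  have h1 : gaussianDensity m v = fun x => gaussianDensity 0 v (x - m) :=
    funext (gaussianDensity_eq_sub m v)
  rw [h1]
  exact h0.comp_sub_right m

/-- Finiteness is what identification of a law by its characteristic function requires. -/
lemma isFiniteMeasure_centeredGaussian {v : ℝ} (hv : 0 < v) :
    IsFiniteMeasure (centeredGaussian d v) := by
  refine isFiniteMeasure_withDensity_ofReal ?_
  exact (integrable_gaussianDensity hv 0).2

end Gaussian

/-! ### Transition law of the Ornstein–Uhlenbeck process. -/

section Law

variable {d : ℕ} {Ω : Type*} [MeasurableSpace Ω] {P : Measure Ω} [IsProbabilityMeasure P]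
  {p₀ : Measure (E d)} {T : ℝ} {X : ℝ → Ω → E d}

lemma varCoeff_pos {s : ℝ} (hs : 0 < s) : 0 < varCoeff s := by
  unfold varCoeff
  have : Real.exp (-2 * s) < 1 := Real.exp_lt_one_iff.2 (by linarith)
  linarith

/-- The Euler-type approximation of the stochastic integral `√2 ∫₀ˢ exp (-(s - r)) dB_r`. -/
noncomputable def noiseSum (B : Fin d → ℝ≥0 → Ω → ℝ) (s : ℝ) (n : ℕ) (ω : Ω) : E d :=
  WithLp.toLp 2 fun i => ∑ k ∈ Finset.range (n + 1),
    (Real.exp (-s) * √2 * Real.exp (s * k / (n + 1 : ℕ)))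
      * (B i (s * (k + 1 : ℕ) / (n + 1 : ℕ)).toNNReal ω - B i (s * k / (n + 1 : ℕ)).toNNReal ω)

omit [MeasurableSpace Ω] in
lemma tendsto_noiseSum {s : ℝ} (hs : 0 < s) (hsT : s ≤ T) {B : Fin d → ℝ≥0 → Ω → ℝ} {ω : Ω}
    (hc : ContinuousOn (fun t => X t ω) (Set.Icc 0 T))
    (hB : ∀ t ∈ Set.Icc 0 T, ∀ i : Fin d,
      X t ω i = X 0 ω i - (∫ s in (0 : ℝ)..t, X s ω i) + √2 * B i t.toNNReal ω) :
    Tendsto (fun n => noiseSum B s n ω) atTop (𝓝 (X s ω - meanCoeff s • X 0 ω)) := by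
  have hsub : Set.Icc 0 s ⊆ Set.Icc 0 T := Set.Icc_subset_Icc_right hsT
  have h : ∀ i, Tendsto (fun n => (noiseSum B s n ω) i) atTop
      (𝓝 ((X s ω - meanCoeff s • X 0 ω) i)) := by
    intro i
    have hci : ContinuousOn (fun t => X t ω i) (Set.Icc 0 s) :=
      ((EuclideanSpace.proj i : E d →L[ℝ] ℝ).continuous.comp_continuousOn (hc.mono hsub))
    have := (tendsto_weighted_increments (x := fun t => X t ω i)
      (b := fun t => B i t.toNNReal ω) hs hci (fun t ht => hB t (hsub ht) i)).const_mul
      (Real.exp (-s))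
    have e : Real.exp (-s) * (Real.exp s * X s ω i - X 0 ω i)
        = (X s ω - meanCoeff s • X 0 ω) i := by
      simp only [meanCoeff, PiLp.sub_apply, PiLp.smul_apply, smul_eq_mul]
      rw [mul_sub, ← mul_assoc, ← Real.exp_add]; simp
    rw [← e]
    refine this.congr fun n => ?_
    simp only [noiseSum]
    rw [Finset.mul_sum, Finset.mul_sum]
    exact Finset.sum_congr rfl fun k _ => by ring
  have h2 : Tendsto (fun n i => (noiseSum B s n ω) i) atTop
      (𝓝 (fun i => (X s ω - meanCoeff s • X 0 ω) i)) := tendsto_pi_nhds.2 h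
  exact ((PiLp.continuous_toLp 2 _).tendsto _).comp h2

/-- Independent coordinates turn the characteristic function into a product. All factors have the
same variance, so the squares of the coordinates of `u` assemble into `‖u‖²`. -/
lemma charFun_noiseSum {s : ℝ} (hs : 0 < s) {B : Fin d → ℝ≥0 → Ω → ℝ}
    (hBm : ∀ i t, Measurable (B i t)) (hB : ∀ i, IsBrownianReal (B i) P)
    (hind : iIndepFun (fun i ω t => B i t ω) P) (n : ℕ) (u : E d) :
    charFun (P.map (noiseSum B s n)) u =
      Complex.exp (-((2 * Real.exp (-2 * s) * ∑ k ∈ Finset.range (n + 1),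
        Real.exp (s * k / (n + 1 : ℕ)) ^ 2 * (s / (n + 1 : ℕ)) : ℝ) : ℂ) * (‖u‖ : ℂ) ^ 2 / 2) := by
  set τ : ℕ → ℝ≥0 := fun k => (s * k / (n + 1 : ℕ)).toNNReal with hτ
  have hmono : Monotone τ := by
    intro a b hab
    refine Real.toNNReal_le_toNNReal ?_
    have : (a : ℝ) ≤ b := by exact_mod_cast hab
    gcongr
  have hind' : iIndepFun (fun i ω => ∑ k ∈ Finset.range (n + 1),
      (Real.exp (-s) * √2 * Real.exp (s * k / (n + 1 : ℕ)))
      * (B i (τ (k + 1)) ω - B i (τ k) ω)) P :=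
    hind.comp (fun i (b : ℝ≥0 → ℝ) => ∑ k ∈ Finset.range (n + 1),
      (Real.exp (-s) * √2 * Real.exp (s * k / (n + 1 : ℕ)))
      * (b (τ (k + 1)) - b (τ k))) (fun i => by fun_prop)
  rw [iIndepFun_iff_charFun_pi (fun i => by fun_prop)] at hind'
  have h1 := hind' u
  have h2 : (noiseSum B s n) = fun ω => WithLp.toLp 2 fun i => ∑ k ∈ Finset.range (n + 1),
      (Real.exp (-s) * √2 * Real.exp (s * k / (n + 1 : ℕ)))
      * (B i (τ (k + 1)) ω - B i (τ k) ω) := rfl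
  rw [h2, h1]
  simp_rw [fun i => charFun_weighted_increments (hB i).toIsPreBrownianReal hmono
    (fun k => Real.exp (-s) * √2 * Real.exp (s * k / (n + 1 : ℕ))) (n + 1) (u i)]
  rw [← Complex.exp_sum]
  congr 1
  have h3 : ∑ k ∈ Finset.range (n + 1),
      (Real.exp (-s) * √2 * Real.exp (s * k / (n + 1 : ℕ))) ^ 2 * ((τ (k + 1) : ℝ) - τ k)
      = 2 * Real.exp (-2 * s) * ∑ k ∈ Finset.range (n + 1),
        Real.exp (s * k / (n + 1 : ℕ)) ^ 2 * (s / (n + 1 : ℕ)) := by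
    rw [Finset.mul_sum]
    refine Finset.sum_congr rfl fun k _ => ?_
    have e1 : ((τ (k + 1) : ℝ) - τ k) = s / (n + 1 : ℕ) := by
      simp only [hτ]
      rw [Real.coe_toNNReal _ (by positivity), Real.coe_toNNReal _ (by positivity)]
      push_cast; ring
    have e2 : Real.exp (-2 * s) = Real.exp (-s) ^ 2 := by
      rw [← Real.exp_nat_mul]; congr 1; push_cast; ring
    rw [e1, e2, mul_pow, mul_pow, Real.sq_sqrt (by norm_num)]
    ring
  rw [h3, ← Finset.sum_div, ← Finset.mul_sum]
  congr 2
  have := EuclideanSpace.real_norm_sq_eq u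
  exact_mod_cast this.symm

/-- The transition law of the Ornstein–Uhlenbeck process. -/
theorem IsForwardOU.map_prodMk_sub [IsProbabilityMeasure p₀] (hX : IsForwardOU P p₀ T X)
    {s : ℝ} (hs : 0 < s) (hsT : s ≤ T) :
    P.map (fun ω => (X 0 ω, X s ω - meanCoeff s • X 0 ω))
      = p₀.prod (centeredGaussian d (varCoeff s)) := by
  have hv := varCoeff_pos hs
  have := isFiniteMeasure_centeredGaussian (d := d) hv
  obtain ⟨B, hBm, hB, hind, hind0, hsde⟩ := hX.sde
  have h0 : Measurable (X 0) := hX.measurable 0 ⟨le_rfl, hs.le.trans hsT⟩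
  have hXs : Measurable (X s) := hX.measurable s ⟨hs.le, hsT⟩
  have hZn : ∀ n, Measurable (noiseSum B s n) := by
    intro n
    unfold noiseSum
    fun_prop
  have hfin : IsFiniteMeasure (P.map (fun ω => (X 0 ω, X s ω - meanCoeff s • X 0 ω))) :=
    inferInstance
  -- The joint characteristic function is the limit, by dominated convergence, of those of `(X_0,
  -- noiseSum)`. The latter factor because `noiseSum` is a function of the Brownian motion, which is
  -- independent of `X_0`.
  rw [← charFun_eq_prod_iff]
  intro t
  have hlim : Tendsto (fun n => charFun (P.map fun ω =>
      (WithLp.toLp 2 (X 0 ω, noiseSum B s n ω))) t) atTop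
      (𝓝 (charFun ((P.map (fun ω => (X 0 ω, X s ω - meanCoeff s • X 0 ω))).map (WithLp.toLp 2))
        t)) := by
    rw [Measure.map_map (by fun_prop) (by fun_prop)]
    simp_rw [charFun_apply]
    rw [integral_map (by fun_prop) (by fun_prop)]
    have : ∀ n, ∫ x, Complex.exp (⟪x, t⟫_ℝ * Complex.I)
        ∂(P.map fun ω => (WithLp.toLp 2 (X 0 ω, noiseSum B s n ω)))
        = ∫ ω, Complex.exp (⟪(WithLp.toLp 2 (X 0 ω, noiseSum B s n ω)), t⟫_ℝ * Complex.I) ∂P := by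
      intro n
      rw [integral_map (by fun_prop) (by fun_prop)]
    simp_rw [this]
    refine tendsto_integral_of_dominated_convergence (fun _ => 1) ?_ (integrable_const _) ?_ ?_
    · intro n; fun_prop
    · intro n
      refine Eventually.of_forall fun ω => ?_
      rw [Complex.norm_exp_ofReal_mul_I]
    · filter_upwards [hsde, hX.continuousOn] with ω h1 h2
      have h3 := tendsto_noiseSum hs hsT h2 h1
      have h4 : Continuous fun z : E d =>
        Complex.exp (⟪(WithLp.toLp 2 (X 0 ω, z)), t⟫_ℝ * Complex.I) := by fun_prop
      exact (h4.tendsto _).comp h3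
  refine tendsto_nhds_unique hlim ?_
  have hval : ∀ n, charFun (P.map fun ω => (WithLp.toLp 2 (X 0 ω, noiseSum B s n ω))) t
      = charFun p₀ t.ofLp.1 * charFun (P.map (noiseSum B s n)) t.ofLp.2 := by
    intro n
    have : IndepFun (X 0) (noiseSum B s n) P := by
      refine hind0.comp (φ := id) (ψ := fun b : Fin d → ℝ≥0 → ℝ => WithLp.toLp 2 fun i =>
        ∑ k ∈ Finset.range (n + 1),
          (Real.exp (-s) * √2 * Real.exp (s * k / (n + 1 : ℕ)))
          * (b i (s * (k + 1 : ℕ) / (n + 1 : ℕ)).toNNReal - b i (s * k / (n + 1 : ℕ)).toNNReal))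
        measurable_id (by fun_prop)
    rw [indepFun_iff_charFun_prod h0.aemeasurable (hZn n).aemeasurable] at this
    rw [this t, hX.map_zero]
  simp_rw [hval, charFun_noiseSum hs hBm hB hind, charFun_centeredGaussian hv]
  refine Tendsto.const_mul _ ?_
  have h1 := (tendsto_exp_riemann_sum s hs).const_mul (2 * Real.exp (-2 * s))
  have h2 : 2 * Real.exp (-2 * s) * ((Real.exp (2 * s) - 1) / 2) = varCoeff s := by
    have : Real.exp (-2 * s) * Real.exp (2 * s) = 1 := by
      rw [← Real.exp_add]; simp
    unfold varCoeff
    linarith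
  rw [h2] at h1
  have h4 : Continuous fun z : ℝ =>
    Complex.exp (-(z : ℂ) * (‖t.ofLp.2‖ : ℂ) ^ 2 / 2) := by fun_prop
  exact (h4.tendsto _).comp h1

/-- The joint law of `(X_0, X_s)`. -/
theorem IsForwardOU.map_prodMk [IsProbabilityMeasure p₀] (hX : IsForwardOU P p₀ T X)
    {s : ℝ} (hs : 0 < s) (hsT : s ≤ T) :
    P.map (fun ω => (X 0 ω, X s ω)) = (p₀.prod volume).withDensity fun z =>
      ENNReal.ofReal (gaussianDensity (meanCoeff s • z.1) (varCoeff s) z.2) := by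
  have h := hX.map_prodMk_sub hs hsT
  have h0 : Measurable (X 0) := hX.measurable 0 ⟨le_rfl, hs.le.trans hsT⟩
  have hXs : Measurable (X s) := hX.measurable s ⟨hs.le, hsT⟩
  have hgm : Measurable fun z : E d × E d =>
      ENNReal.ofReal (gaussianDensity (meanCoeff s • z.1) (varCoeff s) z.2) := by
    unfold gaussianDensity; fun_prop
  have := isFiniteMeasure_centeredGaussian (d := d) (varCoeff_pos hs)
  have e : (fun ω => (X 0 ω, X s ω))
      = (fun z : E d × E d => (z.1, meanCoeff s • z.1 + z.2)) ∘
        fun ω => (X 0 ω, X s ω - meanCoeff s • X 0 ω) := by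
    ext ω <;> simp
  rw [e, ← Measure.map_map (by fun_prop) (by fun_prop), h]
  refine Measure.ext_of_lintegral _ fun f hf => ?_
  rw [lintegral_map hf (by fun_prop), lintegral_withDensity_eq_lintegral_mul _ hgm hf,
    lintegral_prod _ (by fun_prop), lintegral_prod _ (by fun_prop)]
  refine lintegral_congr fun x₀ => ?_
  rw [centeredGaussian, lintegral_withDensity_eq_lintegral_mul _
    (by unfold gaussianDensity; fun_prop) (by fun_prop)]
  symm
  -- Translation invariance of Lebesgue measure recentres the Gaussian at `meanCoeff s • x₀`.
  rw [← lintegral_add_left_eq_self _ (meanCoeff s • x₀)]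
  refine lintegral_congr fun z => ?_
  simp [gaussianDensity]

end Law

/-! ### Calculus of weak gradients. -/

section WeakGradient

variable {d : ℕ} {f f' g : E d → ℝ} {G G' : E d → E d}

lemma gradient_apply_coord {f : E d → ℝ} (x : E d) (k : Fin d) :
    gradient f x k = fderiv ℝ f x (EuclideanSpace.single k 1) := by
  have h : ⟪gradient f x, EuclideanSpace.single k (1 : ℝ)⟫_ℝ
      = fderiv ℝ f x (EuclideanSpace.single k 1) := by
    rw [gradient, InnerProductSpace.toDual_symm_apply]
  rw [← h, EuclideanSpace.inner_single_right]
  simp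

lemma continuous_gradient (hf : ContDiff ℝ 1 f) : Continuous (gradient f) := by
  unfold gradient
  exact (LinearIsometryEquiv.continuous _).comp (hf.continuous_fderiv (by norm_num))

lemma locallyIntegrable_coord (hG : LocallyIntegrable G volume) (k : Fin d) :
    LocallyIntegrable (fun x => G x k) volume := by
  intro x
  obtain ⟨s, hs, h⟩ := hG x
  exact ⟨s, hs, (EuclideanSpace.proj k : E d →L[ℝ] ℝ).integrable_comp h⟩

lemma continuous_coord_fderiv {φ : E d → ℝ} (hφ : ContDiff ℝ 1 φ) (k : Fin d) :
    Continuous fun x => fderiv ℝ φ x (EuclideanSpace.single k 1) :=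
  (hφ.continuous_fderiv (by norm_num)).clm_apply continuous_const

lemma hasCompactSupport_coord_fderiv {φ : E d → ℝ} (hφ : HasCompactSupport φ) (k : Fin d) :
    HasCompactSupport fun x => fderiv ℝ φ x (EuclideanSpace.single k 1) :=
  (hφ.fderiv (𝕜 := ℝ)).comp_left (g := fun L : E d →L[ℝ] ℝ => L (EuclideanSpace.single k 1))
    (by simp)

lemma integrable_mul_test {φ : E d → ℝ} (hf : LocallyIntegrable f volume)
    (hφ : Continuous φ) (hc : HasCompactSupport φ) : Integrable (fun x => f x * φ x) volume := by
  have := hf.integrable_smul_right_of_hasCompactSupport hφ hc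
  simpa [smul_eq_mul] using this

lemma HasWeakGradient.congr (h : HasWeakGradient f G) (hf : f =ᵐ[volume] f')
    (hG : G =ᵐ[volume] G') : HasWeakGradient f' G' where
  locallyIntegrable := h.locallyIntegrable.congr hf
  locallyIntegrable_grad := h.locallyIntegrable_grad.congr hG
  integral_eq φ hφ hc k := by
    have e1 : ∫ x, f' x * fderiv ℝ φ x (EuclideanSpace.single k 1)
        = ∫ x, f x * fderiv ℝ φ x (EuclideanSpace.single k 1) :=
      integral_congr_ae (hf.mono fun x hx => by simp only [hx])
    have e2 : ∫ x, G' x k * φ x = ∫ x, G x k * φ x :=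
      integral_congr_ae (hG.mono fun x hx => by simp only [hx])
    rw [e1, e2, h.integral_eq φ hφ hc k]

/-- The fundamental lemma of the calculus of variations, applied in each coordinate. It makes
results independent of the choice inside `weakGrad`. -/
lemma HasWeakGradient.ae_eq (h : HasWeakGradient f G) (h' : HasWeakGradient f G') :
    G =ᵐ[volume] G' := by
  have hk : ∀ k : Fin d, ∀ᵐ x, G x k = G' x k := by
    intro k
    refine ae_eq_of_integral_contDiff_smul_eq
      (locallyIntegrable_coord h.locallyIntegrable_grad k)
      (locallyIntegrable_coord h'.locallyIntegrable_grad k) fun φ hφ hc => ?_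
    have := (h.integral_eq φ hφ hc k).symm.trans (h'.integral_eq φ hφ hc k)
    simp only [smul_eq_mul, mul_comm (φ _)]
    linarith
  filter_upwards [ae_all_iff.2 hk] with x hx
  ext k
  exact hx k

lemma HasWeakGradient.weakGrad_ae_eq (h : HasWeakGradient f G) :
    DoobMatching.weakGrad f =ᵐ[volume] G :=
  h.weakGrad.ae_eq h

lemma HasWeakGradient.add_smul (h : HasWeakGradient f G) (h' : HasWeakGradient g G') (c : ℝ) :
    HasWeakGradient (fun x => f x + c * g x) (fun x => G x + c • G' x) where
  locallyIntegrable := h.locallyIntegrable.add (h'.locallyIntegrable.smul c)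
  locallyIntegrable_grad := h.locallyIntegrable_grad.add (h'.locallyIntegrable_grad.smul c)
  integral_eq φ hφ hc k := by
    have i1 := h.integral_eq φ hφ hc k
    have i2 := h'.integral_eq φ hφ hc k
    have hφ1 : ContDiff ℝ 1 φ := hφ.of_le (by exact_mod_cast le_top)
    have a1 := integrable_mul_test h.locallyIntegrable (continuous_coord_fderiv hφ1 k)
      (hasCompactSupport_coord_fderiv hc k)
    have a2 := integrable_mul_test h'.locallyIntegrable (continuous_coord_fderiv hφ1 k)
      (hasCompactSupport_coord_fderiv hc k)
    have a3 := integrable_mul_test (locallyIntegrable_coord h.locallyIntegrable_grad k)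
      hφ.continuous hc
    have a4 := integrable_mul_test (locallyIntegrable_coord h'.locallyIntegrable_grad k)
      hφ.continuous hc
    have e1 : ∀ x, (f x + c * g x) * fderiv ℝ φ x (EuclideanSpace.single k 1)
      = f x * fderiv ℝ φ x (EuclideanSpace.single k 1)
        + c * (g x * fderiv ℝ φ x (EuclideanSpace.single k 1)) := fun x => by ring
    have e2 : ∀ x, (G x + c • G' x) k * φ x = G x k * φ x + c * (G' x k * φ x) := fun x => by
      simp only [PiLp.add_apply, PiLp.smul_apply, smul_eq_mul]; ring
    simp_rw [e1, e2]
    rw [integral_add a1 (a2.const_mul c), integral_add a3 (a4.const_mul c), integral_const_mul,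
      integral_const_mul, i1, i2]
    ring

lemma HasWeakGradient.of_contDiff (hf : ContDiff ℝ 1 f) : HasWeakGradient f (gradient f) where
  locallyIntegrable := hf.continuous.locallyIntegrable
  locallyIntegrable_grad := (continuous_gradient hf).locallyIntegrable
  integral_eq φ hφ hc k := by
    have hφ1 : ContDiff ℝ 1 φ := hφ.of_le (by exact_mod_cast le_top)
    simp_rw [gradient_apply_coord]
    refine integral_mul_fderiv_eq_neg_fderiv_mul_of_integrable ?_ ?_ ?_ ?_ ?_
    · exact integrable_mul_test (continuous_coord_fderiv hf k).locallyIntegrable hφ.continuous hc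
    · exact integrable_mul_test hf.continuous.locallyIntegrable (continuous_coord_fderiv hφ1 k)
        (hasCompactSupport_coord_fderiv hc k)
    · exact integrable_mul_test hf.continuous.locallyIntegrable hφ.continuous hc
    · exact fun x _ => (hf.differentiable (by norm_num)) x
    · exact fun x _ => (hφ1.differentiable (by norm_num)) x

lemma weakGrad_ae_eq_gradient {F : E d → ℝ} (hF : ContDiff ℝ 1 F) (hf : f =ᵐ[volume] F) :
    weakGrad f =ᵐ[volume] gradient F :=
  ((HasWeakGradient.of_contDiff hF).congr hf.symm EventuallyEq.rfl).weakGrad_ae_eq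

/-- Doob's function is only known almost everywhere, so membership must be read off from a smooth
representative `F`. -/
lemma memH1_of_contDiff {ν : Measure (E d)} (hν : ν ≪ volume) {F : E d → ℝ}
    (hF : ContDiff ℝ 1 F) (hf : f =ᵐ[volume] F) (hL : MemLp F 2 ν)
    (hL' : MemLp (gradient F) 2 ν) : MemH1 ν f where
  memLp := hL.ae_eq (hν.ae_eq hf.symm)
  exists_weakGradient := ⟨_, (HasWeakGradient.of_contDiff hF).congr hf.symm EventuallyEq.rfl⟩
  memLp_weakGrad := hL'.ae_eq (hν.ae_eq (weakGrad_ae_eq_gradient hF hf).symm)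

lemma MemH1.hasWeakGradient {ν : Measure (E d)} (h : MemH1 ν f) : HasWeakGradient f (weakGrad f) :=
  h.exists_weakGradient.choose_spec.weakGrad

lemma MemH1.weakGrad_add_smul {ν : Measure (E d)} (hf : MemH1 ν f)
    (hg : MemH1 ν g) (c : ℝ) : weakGrad (fun x => f x + c * g x)
      =ᵐ[volume] fun x => weakGrad f x + c • weakGrad g x :=
  (hf.hasWeakGradient.add_smul hg.hasWeakGradient c).weakGrad_ae_eq

lemma MemH1.add_smul {ν : Measure (E d)} (hν : ν ≪ volume) (hf : MemH1 ν f)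
    (hg : MemH1 ν g) (c : ℝ) : MemH1 ν (fun x => f x + c * g x) where
  memLp := hf.memLp.add (hg.memLp.const_mul c)
  exists_weakGradient := ⟨_, hf.hasWeakGradient.add_smul hg.hasWeakGradient c⟩
  memLp_weakGrad := (hf.memLp_weakGrad.add (hg.memLp_weakGrad.const_smul c)).ae_eq
    (hν.ae_eq (hf.weakGrad_add_smul hg c).symm)

end WeakGradient

/-! ### Smooth cutoffs exhausting the space. -/

section Cutoff

variable {d : ℕ}

/-- Dilations `b(x/(n+1))` of a single bump: the gradient gains a factor `1/(n+1)`, hence is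
uniformly bounded and vanishes in the limit. -/
lemma exists_cutoff (d : ℕ) : ∃ (χ : ℕ → E d → ℝ) (C : ℝ),
    (∀ n, ContDiff ℝ (⊤ : ℕ∞) (χ n)) ∧ (∀ n, HasCompactSupport (χ n)) ∧
    (∀ n x, |χ n x| ≤ 1) ∧ (∀ n x, ‖gradient (χ n) x‖ ≤ C) ∧
    (∀ x, Tendsto (fun n => χ n x) atTop (𝓝 1)) ∧
    (∀ x, Tendsto (fun n => gradient (χ n) x) atTop (𝓝 0)) := by
  let b : ContDiffBump (0 : E d) := ⟨1, 2, by norm_num, by norm_num⟩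
  have hb : ContDiff ℝ (⊤ : ℕ∞) b := b.contDiff
  have hb1 : ContDiff ℝ 1 b := b.contDiff
  obtain ⟨C, hC⟩ := (hb1.continuous_fderiv (by norm_num)).bounded_above_of_compact_support
    (b.hasCompactSupport.fderiv (𝕜 := ℝ))
  have hC0 : 0 ≤ C := (norm_nonneg _).trans (hC 0)
  have ha : ∀ n : ℕ, (0 : ℝ) < 1 / ((n : ℝ) + 1) := fun n => by positivity
  have hgrad : ∀ (n : ℕ) (x : E d), ‖gradient (fun x => b ((1 / ((n : ℝ) + 1)) • x)) x‖
      ≤ 1 / ((n : ℝ) + 1) * C := by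
    intro n x
    rw [gradient, LinearIsometryEquiv.norm_map, fderiv_comp_smul, norm_smul,
      Real.norm_of_nonneg (ha n).le]
    exact mul_le_mul_of_nonneg_left (hC _) (ha n).le
  refine ⟨fun n x => b ((1 / ((n : ℝ) + 1)) • x), C, ?_, ?_, ?_, ?_, ?_, ?_⟩
  · intro n; exact hb.comp (contDiff_const_smul _)
  · intro n; exact b.hasCompactSupport.comp_smul (ha n).ne'
  · intro n x; rw [abs_of_nonneg b.nonneg]; exact b.le_one
  · intro n x
    refine (hgrad n x).trans ?_
    have : 1 / ((n : ℝ) + 1) ≤ 1 := by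
      rw [div_le_one (by positivity)]
      have : (0 : ℝ) ≤ n := Nat.cast_nonneg n
      linarith
    nlinarith
  · intro x
    have h0 : Tendsto (fun n : ℕ => (1 / ((n : ℝ) + 1)) • x) atTop (𝓝 0) := by
      simpa using (tendsto_one_div_add_atTop_nhds_zero_nat (𝕜 := ℝ)).smul_const x
    have h1 := (hb.continuous.tendsto 0).comp h0
    rwa [b.one_of_mem_closedBall (by simp [b])] at h1
  · intro x
    refine squeeze_zero_norm (fun n => hgrad n x) ?_
    simpa using tendsto_one_div_add_atTop_nhds_zero_nat.mul_const C

end Cutoff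

/-! ### Symmetry of the generator in the weighted space. -/

section IntegrationByParts

variable {d : ℕ} {p u g : E d → ℝ}

lemma real_inner_eq_sum (x y : E d) : ⟪x, y⟫_ℝ = ∑ k, x k * y k := by
  rw [PiLp.inner_apply]
  exact Finset.sum_congr rfl fun k _ => by simp [mul_comm]

lemma fderiv_mul_mul_apply {a b c : E d → ℝ} (x v : E d) (ha : DifferentiableAt ℝ a x)
    (hb : DifferentiableAt ℝ b x) (hc : DifferentiableAt ℝ c x) :
    fderiv ℝ (fun x => a x * (b x * c x)) x v
      = fderiv ℝ a x v * (b x * c x) + a x * (fderiv ℝ b x v * c x + b x * fderiv ℝ c x v) := by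
  rw [fderiv_fun_mul ha (hb.fun_mul hc)]
  simp only [add_apply, smul_apply, smul_eq_mul]
  rw [fderiv_fun_mul hb hc]
  simp only [add_apply, smul_apply, smul_eq_mul]
  ring

lemma gradient_log_coord {p : E d → ℝ} {x : E d} (hp : DifferentiableAt ℝ p x) (h0 : 0 < p x)
    (k : Fin d) : gradient (fun y => Real.log (p y)) x k
      = fderiv ℝ p x (EuclideanSpace.single k 1) / p x := by
  rw [gradient_apply_coord, fderiv.log hp h0.ne']
  simp [div_eq_inv_mul]

/-- The generator `Δu + ∇u · ∇ log p` of the diffusion that is reversible for `p dx`. -/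
noncomputable def generator (p u : E d → ℝ) (x : E d) : ℝ :=
  ∑ k, fderiv ℝ (fun y => fderiv ℝ u y (EuclideanSpace.single k 1)) x (EuclideanSpace.single k 1)
    + ⟪gradient u x, gradient (fun y => Real.log (p y)) x⟫_ℝ

lemma integral_withDensity_ofReal {p : E d → ℝ} (hp : Continuous p) (hpos : ∀ x, 0 < p x)
    (f : E d → ℝ) : ∫ x, f x ∂(volume.withDensity fun x => ENNReal.ofReal (p x))
      = ∫ x, p x * f x := by
  rw [integral_withDensity_eq_integral_toReal_smul]
  · refine integral_congr_ae (Eventually.of_forall fun z => ?_)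
    simp only [ENNReal.toReal_ofReal (hpos z).le, smul_eq_mul]
  · exact hp.measurable.ennreal_ofReal
  · exact Eventually.of_forall fun z => ENNReal.ofReal_lt_top

/-- The weak gradient of `g` is tested coordinatewise against the field `χ p ∇u`, whose divergence
is `p (∇χ·∇u + χ Lu)` because `∇p = p ∇log p`. -/
lemma integral_cutoff_generator (hp : ContDiff ℝ (⊤ : ℕ∞) p) (hpos : ∀ x, 0 < p x)
    (hu : ContDiff ℝ (⊤ : ℕ∞) u) {G : E d → E d} (hg : HasWeakGradient g G) {χ : E d → ℝ}
    (hχ : ContDiff ℝ (⊤ : ℕ∞) χ) (hc : HasCompactSupport χ) :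
    ∫ x, p x * (g x * (⟪gradient χ x, gradient u x⟫_ℝ + χ x * generator p u x))
      = - ∫ x, p x * (⟪G x, gradient u x⟫_ℝ * χ x) := by
  set Du : Fin d → E d → ℝ := fun k x => fderiv ℝ u x (EuclideanSpace.single k 1) with hDu
  have hDuc : ∀ k, ContDiff ℝ (⊤ : ℕ∞) (Du k) := fun k =>
    (hu.fderiv_right (m := (⊤ : ℕ∞)) (by simp)).clm_apply contDiff_const
  set φ : Fin d → E d → ℝ := fun k x => χ x * (p x * Du k x) with hφ
  have hφc : ∀ k, ContDiff ℝ (⊤ : ℕ∞) (φ k) := fun k => hχ.mul (hp.mul (hDuc k))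
  have hφ1 : ∀ k, ContDiff ℝ 1 (φ k) := fun k => (hφc k).of_le (by exact_mod_cast le_top)
  have hφs : ∀ k, HasCompactSupport (φ k) := fun k => hc.mul_right
  have h1 := fun k => hg.integral_eq (φ k) (hφc k) (hφs k) k
  have hd : ∀ {f : E d → ℝ}, ContDiff ℝ (⊤ : ℕ∞) f → ∀ x, DifferentiableAt ℝ f x :=
    fun hf x => hf.differentiable (by simp) x
  have i1 : ∀ k ∈ Finset.univ, Integrable
      (fun x => g x * fderiv ℝ (φ k) x (EuclideanSpace.single k 1)) volume := fun k _ =>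
    integrable_mul_test hg.locallyIntegrable (continuous_coord_fderiv (hφ1 k) k)
      (hasCompactSupport_coord_fderiv (hφs k) k)
  have i2 : ∀ k ∈ Finset.univ, Integrable (fun x => G x k * φ k x) volume := fun k _ =>
    integrable_mul_test (locallyIntegrable_coord hg.locallyIntegrable_grad k)
      (hφc k).continuous (hφs k)
  have e1 : ∀ x, p x * (g x * (⟪gradient χ x, gradient u x⟫_ℝ + χ x * generator p u x))
      = ∑ k, g x * fderiv ℝ (φ k) x (EuclideanSpace.single k 1) := by
    intro x
    rw [← Finset.mul_sum, generator, real_inner_eq_sum, real_inner_eq_sum,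
      ← Finset.sum_add_distrib, Finset.mul_sum (a := χ x), ← Finset.sum_add_distrib, mul_left_comm]
    congr 1
    rw [Finset.mul_sum]
    refine Finset.sum_congr rfl fun k _ => ?_
    rw [gradient_log_coord (hd hp x) (hpos x), gradient_apply_coord, gradient_apply_coord,
      hφ, fderiv_mul_mul_apply x _ (hd hχ x) (hd hp x) (hd (hDuc k) x)]
    have := (hpos x).ne'
    simp only [hDu]
    field_simp
    ring
  have e2 : ∀ x, p x * (⟪G x, gradient u x⟫_ℝ * χ x) = ∑ k, G x k * φ k x := by
    intro x
    rw [real_inner_eq_sum, Finset.sum_mul, Finset.mul_sum]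
    refine Finset.sum_congr rfl fun k _ => ?_
    rw [gradient_apply_coord]
    simp only [hφ, hDu]
    ring
  simp_rw [e1, e2]
  rw [integral_finsetSum _ i1, integral_finsetSum _ i2, ← Finset.sum_neg_distrib]
  exact Finset.sum_congr rfl fun k _ => h1 k

lemma memLp_two_integrable_mul {α : Type*} [MeasurableSpace α] {ν : Measure α} {f g : α → ℝ}
    (hf : MemLp f 2 ν) (hg : MemLp g 2 ν) : Integrable (fun x => f x * g x) ν :=
  hf.integrable_mul hg

/-- The cutoff is removed by dominated convergence. The dominating functions are products of two
`L²` functions, and the term with `∇χ` disappears in the limit. -/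
lemma integral_inner_weakGrad_gradient (hp : ContDiff ℝ (⊤ : ℕ∞) p) (hpos : ∀ x, 0 < p x)
    (hu : ContDiff ℝ (⊤ : ℕ∞) u)
    (hg : MemH1 (volume.withDensity fun x => ENNReal.ofReal (p x)) g)
    (hu1 : MemLp (gradient u) 2 (volume.withDensity fun x => ENNReal.ofReal (p x)))
    (hR : MemLp (generator p u) 2 (volume.withDensity fun x => ENNReal.ofReal (p x))) :
    ∫ x, ⟪weakGrad g x, gradient u x⟫_ℝ ∂(volume.withDensity fun x => ENNReal.ofReal (p x))
      = - ∫ x, g x * generator p u x ∂(volume.withDensity fun x => ENNReal.ofReal (p x)) := by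
  set ν := volume.withDensity fun x => ENNReal.ofReal (p x) with hν
  obtain ⟨χ, C, hχ, hc, hχ1, hgC, hlim, hglim⟩ := exists_cutoff d
  have hu' : ContDiff ℝ 1 u := hu.of_le (by exact_mod_cast le_top)
  have hχ' : ∀ n, ContDiff ℝ 1 (χ n) := fun n => (hχ n).of_le (by exact_mod_cast le_top)
  have key : ∀ n, ∫ x, g x * (⟪gradient (χ n) x, gradient u x⟫_ℝ + χ n x * generator p u x) ∂ν
      = - ∫ x, ⟪weakGrad g x, gradient u x⟫_ℝ * χ n x ∂ν := by
    intro n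
    rw [hν, integral_withDensity_ofReal hp.continuous hpos,
      integral_withDensity_ofReal hp.continuous hpos]
    exact integral_cutoff_generator hp hpos hu hg.hasWeakGradient (hχ n) (hc n)
  have gm := hg.memLp.aestronglyMeasurable
  have wm := hg.memLp_weakGrad.aestronglyMeasurable
  have um := hu1.aestronglyMeasurable
  have Rm := hR.aestronglyMeasurable
  have χm : ∀ n, AEStronglyMeasurable (χ n) ν := fun n => (hχ n).continuous.aestronglyMeasurable
  have χgm : ∀ n, AEStronglyMeasurable (gradient (χ n)) ν := fun n =>
    (continuous_gradient (hχ' n)).aestronglyMeasurable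
  have t1 : Tendsto (fun n => ∫ x, g x * (⟪gradient (χ n) x, gradient u x⟫_ℝ
      + χ n x * generator p u x) ∂ν) atTop (𝓝 (∫ x, g x * generator p u x ∂ν)) := by
    refine tendsto_integral_of_dominated_convergence
      (fun x => |g x| * (C * ‖gradient u x‖ + |generator p u x|)) ?_ ?_ ?_ ?_
    · intro n
      exact gm.mul (((χgm n).inner um).add ((χm n).mul Rm))
    · exact memLp_two_integrable_mul hg.memLp.norm ((hu1.norm.const_mul C).add hR.norm)
    · intro n
      refine Eventually.of_forall fun x => ?_
      rw [norm_mul, Real.norm_eq_abs, Real.norm_eq_abs]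
      refine mul_le_mul_of_nonneg_left ((abs_add_le _ _).trans (add_le_add ?_ ?_)) (abs_nonneg _)
      · exact (abs_real_inner_le_norm _ _).trans
          (mul_le_mul_of_nonneg_right (hgC n x) (norm_nonneg _))
      · rw [abs_mul]
        exact mul_le_of_le_one_left (abs_nonneg _) (hχ1 n x)
    · refine Eventually.of_forall fun x => ?_
      have := (((hglim x).inner (tendsto_const_nhds (x := gradient u x))).add
        ((hlim x).mul_const (generator p u x))).const_mul (g x)
      simpa using this
  have t2 : Tendsto (fun n => - ∫ x, ⟪weakGrad g x, gradient u x⟫_ℝ * χ n x ∂ν) atTop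
      (𝓝 (- ∫ x, ⟪weakGrad g x, gradient u x⟫_ℝ ∂ν)) := by
    refine Tendsto.neg (tendsto_integral_of_dominated_convergence
      (fun x => ‖weakGrad g x‖ * ‖gradient u x‖) ?_ ?_ ?_ ?_)
    · intro n
      exact (wm.inner um).mul (χm n)
    · exact memLp_two_integrable_mul hg.memLp_weakGrad.norm hu1.norm
    · intro n
      refine Eventually.of_forall fun x => ?_
      rw [norm_mul, Real.norm_eq_abs, Real.norm_eq_abs]
      exact (mul_le_of_le_one_right (abs_nonneg _) (hχ1 n x)).trans (abs_real_inner_le_norm _ _)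
    · refine Eventually.of_forall fun x => ?_
      simpa using (hlim x).const_mul ⟪weakGrad g x, gradient u x⟫_ℝ
  simp_rw [key] at t1
  have := tendsto_nhds_unique t1 t2
  linarith

end IntegrationByParts

/-! ### Polynomials times a Gaussian density: derivatives and bounds. -/

section GaussPoly

variable {d : ℕ}

/-- The product of a polynomial with the density of `N(0, v I_d)`. -/
noncomputable def gaussPoly (v : ℝ) (Q : MvPolynomial (Fin d) ℝ) (z : E d) : ℝ :=
  MvPolynomial.eval (fun i => z i) Q * gaussianDensity 0 v z

/-- The polynomial `D` with `∂ₖ (Q φ) = D φ` for the density `φ` of `N(0, v I_d)`. -/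
noncomputable def hermiteStep (v : ℝ) (k : Fin d) (Q : MvPolynomial (Fin d) ℝ) :
    MvPolynomial (Fin d) ℝ :=
  MvPolynomial.pderiv k Q - MvPolynomial.C v⁻¹ * MvPolynomial.X k * Q

lemma continuous_eval (Q : MvPolynomial (Fin d) ℝ) :
    Continuous fun z : E d => MvPolynomial.eval (fun i => z i) Q :=
  (MvPolynomial.continuous_eval Q).comp (by fun_prop)

lemma continuous_gaussPoly (v : ℝ) (Q : MvPolynomial (Fin d) ℝ) : Continuous (gaussPoly v Q) :=
  (continuous_eval Q).mul (continuous_gaussianDensity 0 v)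

lemma hasFDerivAt_eval (Q : MvPolynomial (Fin d) ℝ) (z : E d) :
    HasFDerivAt (fun z : E d => MvPolynomial.eval (fun i => z i) Q)
      (∑ k, MvPolynomial.eval (fun i => z i) (MvPolynomial.pderiv k Q) •
        (EuclideanSpace.proj k : E d →L[ℝ] ℝ)) z := by
  induction Q using MvPolynomial.induction_on with
  | C a => simpa using hasFDerivAt_const a z
  | add p q hp hq =>
    simp only [map_add, add_smul, Finset.sum_add_distrib]
    exact hp.add hq
  | mul_X p n hp =>
    have h1 : HasFDerivAt (fun z : E d => z n) (EuclideanSpace.proj n : E d →L[ℝ] ℝ) z :=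
      (EuclideanSpace.proj n : E d →L[ℝ] ℝ).hasFDerivAt
    refine ((hp.mul h1).congr_fderiv ?_).congr_of_eventuallyEq
      (Eventually.of_forall fun y => by simp)
    simp only [MvPolynomial.pderiv_mul, map_add, map_mul, MvPolynomial.eval_X,
      MvPolynomial.pderiv_X, add_smul, Finset.sum_add_distrib]
    rw [add_comm]
    congr 1
    · rw [Finset.smul_sum]
      refine Finset.sum_congr rfl fun k _ => ?_
      rw [smul_smul, mul_comm]
    · rw [Finset.sum_eq_single n]
      · simp
      · intro k _ hk
        rw [Pi.single_eq_of_ne hk.symm]; simp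
      · simp

lemma hasFDerivAt_gaussianDensity {v : ℝ} (hv : 0 < v) (z : E d) :
    HasFDerivAt (gaussianDensity (0 : E d) v)
      (∑ k, (-v⁻¹ * z k * gaussianDensity 0 v z) • (EuclideanSpace.proj k : E d →L[ℝ] ℝ)) z := by
  have h1 : HasFDerivAt (fun z : E d => ‖z‖ ^ 2) (2 • innerSL ℝ z) z :=
    (hasStrictFDerivAt_norm_sq z).hasFDerivAt
  have h2 := ((h1.const_mul (-(2 * v)⁻¹)).exp).const_mul ((2 * Real.pi * v) ^ (-(d : ℝ) / 2))
  refine (h2.congr_fderiv ?_).congr_of_eventuallyEq (Eventually.of_forall fun y => ?_)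
  · ext y
    simp only [gaussianDensity, sub_zero, smul_apply, smul_eq_mul,
      nsmul_eq_mul, sum_apply, innerSL_apply_apply]
    rw [real_inner_eq_sum, Finset.mul_sum, Finset.mul_sum, Finset.mul_sum, Finset.mul_sum]
    refine Finset.sum_congr rfl fun k _ => ?_
    have e : -‖z‖ ^ 2 / (2 * v) = -(2 * v)⁻¹ * ‖z‖ ^ 2 := by ring
    rw [e]
    simp only [PiLp.proj_apply]
    field_simp
    push_cast
    ring
  · simp only [gaussianDensity, sub_zero]
    congr 2
    ring

lemma hasFDerivAt_gaussPoly {v : ℝ} (hv : 0 < v) (Q : MvPolynomial (Fin d) ℝ) (z : E d) :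
    HasFDerivAt (gaussPoly v Q)
      (∑ k, gaussPoly v (hermiteStep v k Q) z • (EuclideanSpace.proj k : E d →L[ℝ] ℝ)) z := by
  refine ((hasFDerivAt_eval Q z).mul (hasFDerivAt_gaussianDensity hv z)).congr_fderiv ?_
  rw [Finset.smul_sum, Finset.smul_sum, ← Finset.sum_add_distrib]
  refine Finset.sum_congr rfl fun k _ => ?_
  rw [smul_smul, smul_smul, ← add_smul]
  congr 1
  simp only [gaussPoly, hermiteStep, map_sub, map_mul, MvPolynomial.eval_C, MvPolynomial.eval_X]
  ring

lemma exists_abs_eval_le (Q : MvPolynomial (Fin d) ℝ) :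
    ∃ (C : ℝ) (n : ℕ), 0 ≤ C ∧ ∀ z : E d, |MvPolynomial.eval (fun i => z i) Q|
      ≤ C * (1 + ‖z‖) ^ n := by
  induction Q using MvPolynomial.induction_on with
  | C a => exact ⟨|a|, 0, abs_nonneg a, fun z => by simp⟩
  | add p q hp hq =>
    obtain ⟨C, n, hC, h⟩ := hp
    obtain ⟨C', n', hC', h'⟩ := hq
    refine ⟨C + C', max n n', by positivity, fun z => ?_⟩
    rw [map_add, add_mul]
    have h1 : 1 ≤ 1 + ‖z‖ := by linarith [norm_nonneg z]
    refine (abs_add_le _ _).trans (add_le_add ((h z).trans ?_) ((h' z).trans ?_))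
    · exact mul_le_mul_of_nonneg_left (pow_le_pow_right₀ h1 (le_max_left _ _)) hC
    · exact mul_le_mul_of_nonneg_left (pow_le_pow_right₀ h1 (le_max_right _ _)) hC'
  | mul_X p k hp =>
    obtain ⟨C, n, hC, h⟩ := hp
    refine ⟨C, n + 1, hC, fun z => ?_⟩
    rw [map_mul, MvPolynomial.eval_X, abs_mul, pow_succ, ← mul_assoc]
    refine mul_le_mul (h z) ?_ (abs_nonneg _) (by positivity)
    have := PiLp.norm_apply_le z k
    rw [Real.norm_eq_abs] at this
    linarith

/-- Combines `x^n ≤ n! e^x` at `x = 1 + r` with `r ≤ v + r²/(4v)`, which is `(2v - r)² ≥ 0`. -/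
lemma one_add_pow_le_exp {v : ℝ} (hv : 0 < v) (n : ℕ) {r : ℝ} (hr : 0 ≤ r) :
    (1 + r) ^ n ≤ (n.factorial * Real.exp (1 + v)) * Real.exp (r ^ 2 / (4 * v)) := by
  have h1 := Real.pow_div_factorial_le_exp (x := 1 + r) (by linarith) n
  rw [div_le_iff₀ (by positivity)] at h1
  have h2 : 1 + r ≤ 1 + v + r ^ 2 / (4 * v) := by
    have : r ≤ v + r ^ 2 / (4 * v) := by
      have e : v + r ^ 2 / (4 * v) - r = (2 * v - r) ^ 2 / (4 * v) := by field_simp; ring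
      have : 0 ≤ (2 * v - r) ^ 2 / (4 * v) := by positivity
      linarith
    linarith
  have h3 := Real.exp_le_exp.2 h2
  rw [Real.exp_add (1 + v)] at h3
  calc (1 + r) ^ n ≤ Real.exp (1 + r) * n.factorial := h1
    _ ≤ (Real.exp (1 + v) * Real.exp (r ^ 2 / (4 * v))) * n.factorial := by gcongr
    _ = _ := by ring

/-- Doubling the variance leaves a spare factor `e^{-‖z‖²/(4v)}`, which absorbs any polynomial. -/
lemma exists_abs_gaussPoly_le {v : ℝ} (hv : 0 < v) (Q : MvPolynomial (Fin d) ℝ) :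
    ∃ C, 0 ≤ C ∧ ∀ z : E d, |gaussPoly v Q z| ≤ C * gaussianDensity 0 (2 * v) z := by
  obtain ⟨C, n, hC, h⟩ := exists_abs_eval_le Q
  set a := (2 * Real.pi * v) ^ (-(d : ℝ) / 2) with ha
  set b := (2 * Real.pi * (2 * v)) ^ (-(d : ℝ) / 2) with hb
  have ha0 : 0 < a := by positivity
  have hb0 : 0 < b := by positivity
  refine ⟨C * (n.factorial * Real.exp (1 + v)) * a / b, by positivity, fun z => ?_⟩
  rw [gaussPoly, abs_mul, abs_of_pos (gaussianDensity_pos hv 0 z)]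
  have h1 := (h z).trans (mul_le_mul_of_nonneg_left
    (one_add_pow_le_exp hv n (norm_nonneg z)) hC)
  refine (mul_le_mul_of_nonneg_right h1 (gaussianDensity_pos hv 0 z).le).trans (le_of_eq ?_)
  simp only [gaussianDensity, sub_zero, ← ha, ← hb]
  have e : Real.exp (-‖z‖ ^ 2 / (2 * (2 * v)))
      = Real.exp (‖z‖ ^ 2 / (4 * v)) * Real.exp (-‖z‖ ^ 2 / (2 * v)) := by
    rw [← Real.exp_add]; congr 1; field_simp; ring
  rw [e]
  field_simp

lemma gaussianDensity_le {v : ℝ} (hv : 0 < v) (m z : E d) :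
    gaussianDensity m v z ≤ (2 * Real.pi * v) ^ (-(d : ℝ) / 2) := by
  rw [gaussianDensity]
  refine mul_le_of_le_one_right (by positivity) (Real.exp_le_one_iff.2 ?_)
  have : 0 ≤ ‖z - m‖ ^ 2 / (2 * v) := by positivity
  rw [neg_div]; linarith

lemma exists_gaussPoly_bound {v : ℝ} (hv : 0 < v) (Q : MvPolynomial (Fin d) ℝ) :
    ∃ C, ∀ z : E d, |gaussPoly v Q z| ≤ C := by
  obtain ⟨C, hC, h⟩ := exists_abs_gaussPoly_le hv Q
  exact ⟨_, fun z => (h z).trans (mul_le_mul_of_nonneg_left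
    (gaussianDensity_le (by positivity) 0 z) hC)⟩

lemma integrable_gaussPoly {v : ℝ} (hv : 0 < v) (Q : MvPolynomial (Fin d) ℝ) :
    Integrable (gaussPoly v Q) := by
  obtain ⟨C, hC, h⟩ := exists_abs_gaussPoly_le hv Q
  exact ((integrable_gaussianDensity (by positivity) 0).const_mul C).mono'
    (continuous_gaussPoly v Q).aestronglyMeasurable (Eventually.of_forall h)

end GaussPoly

/-! ### Gaussian smoothings of bounded functions. -/

section Smoothing

variable {d : ℕ} {p₀ : Measure (E d)} {g : E d → ℝ} {m v : ℝ}

/-- The function `x ↦ ∫ g(x₀) Q(x - m x₀) φ(x; m x₀, v I_d) p₀(dx₀)`. -/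
noncomputable def smoothing (p₀ : Measure (E d)) (m v : ℝ) (g : E d → ℝ)
    (Q : MvPolynomial (Fin d) ℝ) (x : E d) : ℝ :=
  ∫ x₀, g x₀ * gaussPoly v Q (x - m • x₀) ∂p₀

/-- A bounded measurable function. -/
structure IsBddMeas (g : E d → ℝ) (M : ℝ) : Prop where
  measurable : Measurable g
  abs_le : ∀ x, |g x| ≤ M

lemma IsBddMeas.nonneg {M : ℝ} (hg : IsBddMeas g M) : 0 ≤ M := (abs_nonneg _).trans (hg.abs_le 0)

lemma isBddMeas_one : IsBddMeas (fun _ : E d => (1 : ℝ)) 1 := ⟨measurable_const, by simp⟩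

lemma IsBddMeas.integrable_mul_gaussPoly [IsProbabilityMeasure p₀] {M : ℝ} (hg : IsBddMeas g M)
    (hv : 0 < v) (Q : MvPolynomial (Fin d) ℝ) (x : E d) :
    Integrable (fun x₀ => g x₀ * gaussPoly v Q (x - m • x₀)) p₀ := by
  obtain ⟨C, hC⟩ := exists_gaussPoly_bound hv Q
  have hgm := hg.measurable
  have hc := continuous_gaussPoly v Q
  refine (integrable_const (M * C)).mono' (by fun_prop) (Eventually.of_forall fun x₀ => ?_)
  rw [norm_mul]
  exact mul_le_mul (hg.abs_le _) (hC _) (norm_nonneg _) hg.nonneg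

/-- Differentiation under the integral sign. Every `gaussPoly` is bounded, so a constant dominates
the derivative and is integrable for the probability measure `p₀`. -/
lemma IsBddMeas.hasFDerivAt_smoothing [IsProbabilityMeasure p₀] {M : ℝ} (hg : IsBddMeas g M)
    (hv : 0 < v) (Q : MvPolynomial (Fin d) ℝ) (x : E d) :
    HasFDerivAt (smoothing p₀ m v g Q) (∑ k, smoothing p₀ m v g (hermiteStep v k Q) x •
      (EuclideanSpace.proj k : E d →L[ℝ] ℝ)) x := by
  choose C hC using fun k => exists_gaussPoly_bound hv (hermiteStep v k Q)
  have hgm := hg.measurable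
  have hc := fun Q : MvPolynomial (Fin d) ℝ => continuous_gaussPoly v Q
  have h := hasFDerivAt_integral_of_dominated_of_fderiv_le (μ := p₀) (𝕜 := ℝ) (s := Set.univ)
    (F := fun x x₀ => g x₀ * gaussPoly v Q (x - m • x₀))
    (F' := fun x x₀ => ∑ k, (g x₀ * gaussPoly v (hermiteStep v k Q) (x - m • x₀)) •
      (EuclideanSpace.proj k : E d →L[ℝ] ℝ)) (x₀ := x)
    (bound := fun _ => ∑ k, (M * C k) * ‖(EuclideanSpace.proj k : E d →L[ℝ] ℝ)‖)
    univ_mem ?_ (hg.integrable_mul_gaussPoly hv Q x) ?_ ?_ (integrable_const _) ?_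
  · refine h.congr_fderiv ?_
    rw [integral_finsetSum]
    · refine Finset.sum_congr rfl fun k _ => ?_
      rw [integral_smul_const]
      rfl
    · exact fun k _ => (hg.integrable_mul_gaussPoly hv _ x).smul_const _
  · exact Eventually.of_forall fun y => (hg.integrable_mul_gaussPoly hv Q y).aestronglyMeasurable
  · refine Finset.aestronglyMeasurable_fun_sum _ fun k _ => ?_
    exact ((hg.integrable_mul_gaussPoly hv _ x).smul_const _).aestronglyMeasurable
  · refine Eventually.of_forall fun x₀ y _ => (norm_sum_le _ _).trans
      (Finset.sum_le_sum fun k _ => ?_)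
    rw [norm_smul, norm_mul]
    refine mul_le_mul_of_nonneg_right ?_ (norm_nonneg _)
    exact mul_le_mul (hg.abs_le _) (hC _ _) (norm_nonneg _) hg.nonneg
  · refine Eventually.of_forall fun x₀ y _ => ?_
    have h1 : HasFDerivAt (fun y => y - m • x₀) (ContinuousLinearMap.id ℝ (E d)) y :=
      (hasFDerivAt_id y).sub_const _
    have h2 := ((hasFDerivAt_gaussPoly hv Q (y - m • x₀)).comp y h1).const_mul (g x₀)
    refine h2.congr_fderiv ?_
    rw [ContinuousLinearMap.comp_id, Finset.smul_sum]
    exact Finset.sum_congr rfl fun k _ => by rw [smul_smul]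

lemma IsBddMeas.contDiff_smoothing [IsProbabilityMeasure p₀] {M : ℝ} (hg : IsBddMeas g M)
    (hv : 0 < v) (Q : MvPolynomial (Fin d) ℝ) :
    ContDiff ℝ (⊤ : ℕ∞) (smoothing p₀ m v g Q) := by
  refine contDiff_infty.2 fun n => ?_
  -- The derivative is again made of smoothings, but with other polynomials, so the induction runs
  -- over all `Q` at once.
  induction n generalizing Q with
  | zero =>
    refine contDiff_zero.2 (continuous_iff_continuousAt.2 fun x => ?_)
    exact (hg.hasFDerivAt_smoothing hv Q x).continuousAt
  | succ n ih =>
    push_cast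
    rw [contDiff_succ_iff_fderiv]
    refine ⟨fun x => (hg.hasFDerivAt_smoothing hv Q x).differentiableAt, by simp, ?_⟩
    have e : fderiv ℝ (smoothing p₀ m v g Q) = fun x =>
        ∑ k, smoothing p₀ m v g (hermiteStep v k Q) x •
          (EuclideanSpace.proj k : E d →L[ℝ] ℝ) :=
      funext fun x => (hg.hasFDerivAt_smoothing hv Q x).fderiv
    rw [e]
    exact ContDiff.sum fun k _ => (ih _).smul contDiff_const

lemma IsBddMeas.fderiv_smoothing [IsProbabilityMeasure p₀] {M : ℝ} (hg : IsBddMeas g M)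
    (hv : 0 < v) (Q : MvPolynomial (Fin d) ℝ) (x : E d) (k : Fin d) :
    fderiv ℝ (smoothing p₀ m v g Q) x (EuclideanSpace.single k 1)
      = smoothing p₀ m v g (hermiteStep v k Q) x := by
  rw [(hg.hasFDerivAt_smoothing hv Q x).fderiv, sum_apply]
  rw [Finset.sum_eq_single k]
  · simp
  · intro j _ hj
    simp [hj]
  · simp

lemma integrable_prod_gaussPoly [IsProbabilityMeasure p₀] (hv : 0 < v)
    (Q : MvPolynomial (Fin d) ℝ) :
    Integrable (fun z : E d × E d => gaussPoly v Q (z.2 - m • z.1)) (p₀.prod volume) := by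
  have hc := continuous_gaussPoly v Q
  have hcont : Continuous fun z : E d × E d => gaussPoly v Q (z.2 - m • z.1) :=
    hc.comp (continuous_snd.sub (continuous_fst.const_smul m))
  rw [integrable_prod_iff hcont.aestronglyMeasurable]
  refine ⟨Eventually.of_forall fun x₀ => ?_, ?_⟩
  · exact (integrable_gaussPoly hv Q).comp_sub_right (m • x₀)
  simp_rw [fun x₀ : E d => integral_sub_right_eq_self (μ := volume)
    (fun y : E d => ‖gaussPoly v Q y‖) (m • x₀)]
  exact integrable_const _

lemma IsBddMeas.integrable_smoothing [IsProbabilityMeasure p₀] {M : ℝ} (hg : IsBddMeas g M)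
    (hv : 0 < v) (Q : MvPolynomial (Fin d) ℝ) : Integrable (smoothing p₀ m v g Q) := by
  have h : Integrable (fun z : E d × E d => g z.1 * gaussPoly v Q (z.2 - m • z.1))
      (p₀.prod volume) := by
    have hgm := hg.measurable
    refine (integrable_prod_gaussPoly hv Q).bdd_mul (c := M)
      (hgm.comp measurable_fst).aestronglyMeasurable ?_
    exact Eventually.of_forall fun z => hg.abs_le _
  exact h.integral_prod_right

end Smoothing

/-! ### Quotients of smoothings: regularity and integrability of all orders. -/

section Ratio

variable {d : ℕ} {p₀ : Measure (E d)} {g : E d → ℝ} {m v M : ℝ}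

/-- The conditional expectation of `g(X) Q(Y - m X)` given `Y = x`, where `X ∼ p₀` and
`Y ∼ N(m X, v I_d)` given `X`. -/
noncomputable def ratio (p₀ : Measure (E d)) (m v : ℝ) (g : E d → ℝ)
    (Q : MvPolynomial (Fin d) ℝ) (x : E d) : ℝ :=
  smoothing p₀ m v g Q x / smoothing p₀ m v (fun _ => 1) 1 x

/-- The distribution of `Y`, where `X ∼ p₀` and `Y ∼ N(m X, v I_d)` given `X`. -/
noncomputable def smoothed (p₀ : Measure (E d)) (m v : ℝ) : Measure (E d) :=
  volume.withDensity fun x => ENNReal.ofReal (smoothing p₀ m v (fun _ => 1) 1 x)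

variable [IsProbabilityMeasure p₀]

lemma smoothing_one_pos (hv : 0 < v) (x : E d) : 0 < smoothing p₀ m v (fun _ => 1) 1 x := by
  have hpos : ∀ x₀ : E d, 0 < (1 : ℝ) * gaussPoly v 1 (x - m • x₀) := fun x₀ => by
    simpa [gaussPoly] using gaussianDensity_pos hv 0 (x - m • x₀)
  rw [smoothing, integral_pos_iff_support_of_nonneg (fun x₀ => (hpos x₀).le)
    (isBddMeas_one.integrable_mul_gaussPoly hv 1 x)]
  have : Function.support (fun x₀ : E d => (1 : ℝ) * gaussPoly v 1 (x - m • x₀)) = Set.univ :=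
    Function.support_eq_univ fun x₀ => (hpos x₀).ne'
  rw [this]
  simp

lemma isFiniteMeasure_smoothed (hv : 0 < v) : IsFiniteMeasure (smoothed p₀ m v) :=
  isFiniteMeasure_withDensity_ofReal (isBddMeas_one.integrable_smoothing hv 1).2

lemma IsBddMeas.contDiff_ratio (hg : IsBddMeas g M) (hv : 0 < v) (Q : MvPolynomial (Fin d) ℝ) :
    ContDiff ℝ (⊤ : ℕ∞) (ratio p₀ m v g Q) :=
  (hg.contDiff_smoothing hv Q).div (isBddMeas_one.contDiff_smoothing hv 1)
    fun x => (smoothing_one_pos hv x).ne'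

/-- The quotient rule, in a form that keeps derivatives in the algebra generated by ratios; the last
factor is `∂ₖ log p`. -/
lemma IsBddMeas.fderiv_ratio (hg : IsBddMeas g M) (hv : 0 < v) (Q : MvPolynomial (Fin d) ℝ)
    (k : Fin d) (x : E d) : fderiv ℝ (ratio p₀ m v g Q) x (EuclideanSpace.single k 1)
      = ratio p₀ m v g (hermiteStep v k Q) x
        - ratio p₀ m v g Q x * ratio p₀ m v (fun _ => 1) (hermiteStep v k 1) x := by
  have h0 := (smoothing_one_pos (p₀ := p₀) (m := m) hv x).ne'
  have h1 := (hg.hasFDerivAt_smoothing (p₀ := p₀) (m := m) hv Q x).differentiableAt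
  have h2 := (isBddMeas_one.hasFDerivAt_smoothing (p₀ := p₀) (m := m) hv 1 x).differentiableAt
  have h3 := h1.hasFDerivAt.mul ((hasDerivAt_inv h0).comp_hasFDerivAt x h2.hasFDerivAt)
  have e' : ratio p₀ m v g Q =
    (smoothing p₀ m v g Q * (Inv.inv ∘ smoothing p₀ m v (fun _ => 1) 1)) :=
    funext fun x => div_eq_mul_inv _ _
  conv_lhs => rw [e', h3.fderiv]
  simp only [add_apply, smul_apply, smul_eq_mul]
  rw [hg.fderiv_smoothing hv, isBddMeas_one.fderiv_smoothing hv]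
  simp only [ratio, Function.comp_apply]
  field_simp
  ring

/-- The Cauchy–Schwarz inequality for the conditional expectation. -/
lemma IsBddMeas.ratio_sq_le (hg : IsBddMeas g M) (hv : 0 < v) (Q : MvPolynomial (Fin d) ℝ)
    (x : E d) : ratio p₀ m v g Q x ^ 2 ≤ M ^ 2 * ratio p₀ m v (fun _ => 1) (Q ^ 2) x := by
  have hq := smoothing_one_pos (p₀ := p₀) (m := m) hv x
  set a := ratio p₀ m v g Q x with ha
  set q := smoothing p₀ m v (fun _ => 1) 1 x with hqd
  have i1 := hg.integrable_mul_gaussPoly (p₀ := p₀) (m := m) hv Q x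
  have i2 := isBddMeas_one.integrable_mul_gaussPoly (p₀ := p₀) (m := m) hv (Q ^ 2) x
  have i3 := isBddMeas_one.integrable_mul_gaussPoly (p₀ := p₀) (m := m) hv 1 x
  -- This is `(g Q - a)² ≥ 0` with `|g| ≤ M`, weighted by the density. Its integral has left side
  -- `2a·aq - a²q = a²q`.
  have hle : ∀ x₀ : E d, 2 * a * (g x₀ * gaussPoly v Q (x - m • x₀))
      - a ^ 2 * (1 * gaussPoly v 1 (x - m • x₀))
      ≤ M ^ 2 * (1 * gaussPoly v (Q ^ 2) (x - m • x₀)) := by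
    intro x₀
    simp only [gaussPoly, map_pow, map_one, one_mul]
    set e := MvPolynomial.eval (fun i => (x - m • x₀) i) Q
    have hφ := gaussianDensity_pos hv 0 (x - m • x₀)
    set φ := gaussianDensity 0 v (x - m • x₀)
    have h1 : (g x₀ * e) ^ 2 ≤ M ^ 2 * e ^ 2 := by
      rw [mul_pow]
      exact mul_le_mul_of_nonneg_right (sq_le_sq' (_root_.abs_le.1 (hg.abs_le x₀)).1
        (_root_.abs_le.1 (hg.abs_le x₀)).2) (sq_nonneg e)
    have h2 : 2 * a * (g x₀ * e) - a ^ 2 ≤ M ^ 2 * e ^ 2 := by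
      nlinarith [sq_nonneg (g x₀ * e - a)]
    calc 2 * a * (g x₀ * (e * φ)) - a ^ 2 * φ = (2 * a * (g x₀ * e) - a ^ 2) * φ := by ring
      _ ≤ (M ^ 2 * e ^ 2) * φ := mul_le_mul_of_nonneg_right h2 hφ.le
      _ = _ := by ring
  have e1 : ∫ x₀, (2 * a * (g x₀ * gaussPoly v Q (x - m • x₀))
      - a ^ 2 * (1 * gaussPoly v 1 (x - m • x₀))) ∂p₀
      = 2 * a * smoothing p₀ m v g Q x - a ^ 2 * q := by
    rw [integral_sub (i1.const_mul (2 * a)) (i3.const_mul (a ^ 2)),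
      integral_const_mul (2 * a), integral_const_mul (a ^ 2)]
    rfl
  have e2 : ∫ x₀, M ^ 2 * (1 * gaussPoly v (Q ^ 2) (x - m • x₀)) ∂p₀
      = M ^ 2 * smoothing p₀ m v (fun _ => 1) (Q ^ 2) x := integral_const_mul (M ^ 2) _
  have h := integral_mono (μ := p₀) (f := fun x₀ => 2 * a * (g x₀ * gaussPoly v Q (x - m • x₀))
      - a ^ 2 * (1 * gaussPoly v 1 (x - m • x₀)))
    ((i1.const_mul (2 * a)).sub (i3.const_mul (a ^ 2))) (i2.const_mul (M ^ 2)) hle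
  rw [e1, e2] at h
  have haq : smoothing p₀ m v g Q x = a * q := by
    rw [ha, ratio, ← hqd]; field_simp
  rw [haq] at h
  rw [ratio, ← hqd, mul_div_assoc', le_div_iff₀ hq]
  nlinarith

/-- Iterated Cauchy–Schwarz replaces Jensen's inequality. Powers of two suffice for all `L^q`, and
their evenness avoids absolute values. -/
lemma IsBddMeas.ratio_pow_le (hg : IsBddMeas g M) (hv : 0 < v) (Q : MvPolynomial (Fin d) ℝ)
    (n : ℕ) (x : E d) : ratio p₀ m v g Q x ^ (2 ^ (n + 1))
      ≤ M ^ (2 ^ (n + 1)) * ratio p₀ m v (fun _ => 1) (Q ^ (2 ^ (n + 1))) x := by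
  induction n with
  | zero => simpa using hg.ratio_sq_le hv Q x
  | succ n ih =>
    have h1 := isBddMeas_one.ratio_sq_le (p₀ := p₀) (m := m) hv (Q ^ (2 ^ (n + 1))) x
    rw [← pow_mul, ← pow_succ, one_pow, one_mul] at h1
    have h0 : 0 ≤ ratio p₀ m v g Q x ^ (2 ^ (n + 1)) :=
      Even.pow_nonneg ((Nat.even_pow' (by omega)).2 even_two) _
    rw [pow_succ 2 (n + 1), pow_mul, pow_mul M]
    refine (pow_le_pow_left₀ h0 ih 2).trans ?_
    rw [mul_pow]
    exact mul_le_mul_of_nonneg_left h1 (sq_nonneg _)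

lemma integrable_smoothed_iff (hv : 0 < v) (f : E d → ℝ) :
    Integrable f (smoothed p₀ m v)
      ↔ Integrable fun x => smoothing p₀ m v (fun _ => 1) 1 x * f x := by
  rw [smoothed, integrable_withDensity_iff_integrable_smul'
    ((isBddMeas_one.contDiff_smoothing hv 1).continuous.measurable.ennreal_ofReal)
    (Eventually.of_forall fun z => ENNReal.ofReal_lt_top)]
  simp_rw [ENNReal.toReal_ofReal (smoothing_one_pos hv _).le, smul_eq_mul]

/-- The density of `smoothed` cancels the denominator and leaves a smoothing, integrable by Fubini.
-/
lemma IsBddMeas.integrable_ratio (hg : IsBddMeas g M) (hv : 0 < v)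
    (Q : MvPolynomial (Fin d) ℝ) : Integrable (ratio p₀ m v g Q) (smoothed p₀ m v) := by
  rw [integrable_smoothed_iff hv]
  refine (hg.integrable_smoothing (p₀ := p₀) (m := m) hv Q).congr
    (Eventually.of_forall fun x => ?_)
  have := (smoothing_one_pos (p₀ := p₀) (m := m) hv x).ne'
  simp only [ratio]
  field_simp

/-- Smooth functions that belong to `L^q(ν)` for all finite `q`. -/
structure Tame (ν : Measure (E d)) (f : E d → ℝ) : Prop where
  contDiff : ContDiff ℝ (⊤ : ℕ∞) f
  memLp : ∀ q : ℝ≥0∞, q ≠ ∞ → MemLp f q ν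

lemma IsBddMeas.tame_ratio (hg : IsBddMeas g M) (hv : 0 < v) (Q : MvPolynomial (Fin d) ℝ) :
    Tame (smoothed p₀ m v) (ratio p₀ m v g Q) where
  contDiff := hg.contDiff_ratio hv Q
  memLp q hq := by
    have := isFiniteMeasure_smoothed (p₀ := p₀) (m := m) hv
    obtain ⟨n, hn⟩ := ENNReal.exists_nat_gt hq
    -- On a finite measure it is enough to reach one larger exponent, here a power of two.
    have hle : q ≤ ((2 ^ (n + 1) : ℕ) : ℝ≥0∞) := by
      refine hn.le.trans ?_
      have : n ≤ 2 ^ (n + 1) := (Nat.lt_pow_self one_lt_two).le.trans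
        (Nat.pow_le_pow_right two_pos n.le_succ)
      exact_mod_cast this
    refine MemLp.mono_exponent ?_ hle
    have hm : AEStronglyMeasurable (ratio p₀ m v g Q) (smoothed p₀ m v) :=
      (hg.contDiff_ratio hv Q).continuous.aestronglyMeasurable
    rw [← integrable_norm_rpow_iff hm (by positivity) (by simp)]
    refine ((isBddMeas_one.integrable_ratio hv (Q ^ (2 ^ (n + 1)))).const_mul
      (M ^ (2 ^ (n + 1)))).mono' ?_ (Eventually.of_forall fun x => ?_)
    · exact (hm.norm.aemeasurable.pow_const _).aestronglyMeasurable
    · rw [ENNReal.toReal_natCast, Real.rpow_natCast, norm_pow, norm_norm, ← norm_pow,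
        Real.norm_eq_abs, abs_of_nonneg
          (Even.pow_nonneg ((Nat.even_pow' (by omega)).2 even_two) _)]
      exact hg.ratio_pow_le hv Q n x

omit [IsProbabilityMeasure p₀] in
lemma Tame.sub {ν : Measure (E d)} {f g : E d → ℝ} (hf : Tame ν f) (hg : Tame ν g) :
    Tame ν (fun x => f x - g x) where
  contDiff := hf.contDiff.sub hg.contDiff
  memLp q hq := (hf.memLp q hq).sub (hg.memLp q hq)

-- Hölder with exponents `2q, 2q`. This is why `Tame` asks for every finite `q`: a single `L^q`
-- would not be stable under products.
omit [IsProbabilityMeasure p₀] in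
lemma Tame.mul {ν : Measure (E d)} {f g : E d → ℝ} (hf : Tame ν f) (hg : Tame ν g) :
    Tame ν (fun x => f x * g x) where
  contDiff := hf.contDiff.mul hg.contDiff
  memLp q hq := by
    have h2 : 2 * q ≠ ∞ := ENNReal.mul_ne_top (by simp) hq
    have : ENNReal.HolderTriple (2 * q) (2 * q) q := ⟨by
      rw [ENNReal.mul_inv (by simp) (by simp), ← two_mul, ← mul_assoc,
        ENNReal.mul_inv_cancel (by simp) (by simp), one_mul]⟩
    exact (hg.memLp _ h2).mul' (hf.memLp _ h2)

omit [IsProbabilityMeasure p₀] in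
lemma Tame.sum {ν : Measure (E d)} {ι : Type*} (s : Finset ι) {f : ι → E d → ℝ}
    (hf : ∀ i, Tame ν (f i)) : Tame ν (fun x => ∑ i ∈ s, f i x) where
  contDiff := ContDiff.sum fun i _ => (hf i).contDiff
  memLp q hq := memLp_finsetSum s fun i _ => (hf i).memLp q hq

lemma IsBddMeas.tame_fderiv_ratio (hg : IsBddMeas g M) (hv : 0 < v)
    (Q : MvPolynomial (Fin d) ℝ) (k : Fin d) : Tame (smoothed p₀ m v)
      (fun x => fderiv ℝ (ratio p₀ m v g Q) x (EuclideanSpace.single k 1)) := by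
  simp_rw [hg.fderiv_ratio hv Q k]
  exact (hg.tame_ratio hv _).sub ((hg.tame_ratio hv _).mul (isBddMeas_one.tame_ratio hv _))

lemma IsBddMeas.tame_fderiv_fderiv_ratio (hg : IsBddMeas g M) (hv : 0 < v)
    (Q : MvPolynomial (Fin d) ℝ) (k l : Fin d) : Tame (smoothed p₀ m v)
      (fun x => fderiv ℝ (fun y => fderiv ℝ (ratio p₀ m v g Q) y (EuclideanSpace.single k 1)) x
        (EuclideanSpace.single l 1)) := by
  simp_rw [hg.fderiv_ratio hv Q k]
  have hd : ∀ {g : E d → ℝ} {M : ℝ}, IsBddMeas g M → ∀ Q x,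
      DifferentiableAt ℝ (ratio p₀ m v g Q) x :=
    fun hg Q x => (hg.contDiff_ratio hv Q).differentiable (by simp) x
  -- The sum from the product rule is written as a double subtraction, so that closure under
  -- `Tame.sub` and `Tame.mul` suffices.
  have e : ∀ x, fderiv ℝ (fun y => ratio p₀ m v g (hermiteStep v k Q) y
      - ratio p₀ m v g Q y * ratio p₀ m v (fun _ => 1) (hermiteStep v k 1) y) x
        (EuclideanSpace.single l 1)
      = fderiv ℝ (ratio p₀ m v g (hermiteStep v k Q)) x (EuclideanSpace.single l 1)
        - (ratio p₀ m v g Q x * fderiv ℝ (ratio p₀ m v (fun _ => 1) (hermiteStep v k 1)) x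
            (EuclideanSpace.single l 1)
          - (0 - ratio p₀ m v (fun _ => 1) (hermiteStep v k 1) x)
            * fderiv ℝ (ratio p₀ m v g Q) x (EuclideanSpace.single l 1)) := by
    intro x
    rw [fderiv_fun_sub (hd hg _ x) ((hd hg _ x).fun_mul (hd isBddMeas_one _ x)), sub_apply,
      fderiv_fun_mul (hd hg _ x) (hd isBddMeas_one _ x)]
    simp only [add_apply, smul_apply, smul_eq_mul]
    ring
  simp_rw [e]
  have hz : Tame (smoothed p₀ m v) (fun _ => (0 : ℝ)) := ⟨contDiff_const, fun q _ => MemLp.zero⟩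
  exact (hg.tame_fderiv_ratio hv _ _).sub (((hg.tame_ratio hv _).mul
    (isBddMeas_one.tame_fderiv_ratio hv _ _)).sub
    ((hz.sub (isBddMeas_one.tame_ratio hv _)).mul (hg.tame_fderiv_ratio hv _ _)))

lemma gradient_log_smoothing_coord (hv : 0 < v) (x : E d) (k : Fin d) :
    gradient (fun y => Real.log (smoothing p₀ m v (fun _ => 1) 1 y)) x k
      = ratio p₀ m v (fun _ => 1) (hermiteStep v k 1) x := by
  rw [gradient_log_coord ((isBddMeas_one.hasFDerivAt_smoothing hv 1 x).differentiableAt)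
    (smoothing_one_pos hv x), isBddMeas_one.fderiv_smoothing hv, ratio]

lemma IsBddMeas.memLp_gradient_ratio (hg : IsBddMeas g M) (hv : 0 < v)
    (Q : MvPolynomial (Fin d) ℝ) :
    MemLp (gradient (ratio p₀ m v g Q)) 2 (smoothed p₀ m v) := by
  refine MemLp.of_eval_piLp fun k => ?_
  simp_rw [gradient_apply_coord]
  exact (hg.tame_fderiv_ratio hv Q k).memLp 2 (by simp)

lemma IsBddMeas.memLp_generator_ratio (hg : IsBddMeas g M) (hv : 0 < v)
    (Q : MvPolynomial (Fin d) ℝ) :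
    MemLp (generator (smoothing p₀ m v (fun _ => 1) 1) (ratio p₀ m v g Q)) 2
      (smoothed p₀ m v) := by
  have h1 := (Tame.sum Finset.univ fun k =>
    hg.tame_fderiv_fderiv_ratio (p₀ := p₀) (m := m) hv Q k k).memLp 2 (by simp)
  have h2 := (Tame.sum Finset.univ fun k => (hg.tame_fderiv_ratio (p₀ := p₀) (m := m) hv Q k).mul
    (isBddMeas_one.tame_ratio hv (hermiteStep v k 1))).memLp 2 (by simp)
  refine (h1.add h2).ae_eq (Eventually.of_forall fun x => ?_)
  simp only [generator, Pi.add_apply, real_inner_eq_sum, gradient_log_smoothing_coord hv,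
    gradient_apply_coord]

omit [IsProbabilityMeasure p₀] in
lemma smoothed_absolutelyContinuous : smoothed p₀ m v ≪ volume :=
  withDensity_absolutelyContinuous _ _

/-- The density is strictly positive. Hence identities that hold almost surely at `X_s` hold
Lebesgue-almost everywhere, as weak derivatives require. -/
lemma volume_absolutelyContinuous_smoothed (hv : 0 < v) : volume ≪ smoothed p₀ m v := by
  refine withDensity_absolutelyContinuous'
    (isBddMeas_one.contDiff_smoothing hv 1).continuous.measurable.ennreal_ofReal.aemeasurable
    (Eventually.of_forall fun x => ?_)
  simpa using smoothing_one_pos hv x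

lemma IsBddMeas.memH2_ratio (hg : IsBddMeas g M) (hv : 0 < v) (Q : MvPolynomial (Fin d) ℝ)
    {f : E d → ℝ} (hf : f =ᵐ[volume] ratio p₀ m v g Q) : MemH2 (smoothed p₀ m v) f := by
  have hC := (hg.contDiff_ratio (p₀ := p₀) (m := m) hv Q).of_le
    (m := 1) (by exact_mod_cast le_top)
  refine ⟨memH1_of_contDiff smoothed_absolutelyContinuous hC hf
    ((hg.tame_ratio hv Q).memLp 2 (by simp)) (hg.memLp_gradient_ratio hv Q), fun k => ?_⟩
  have hk : (fun x => weakGrad f x k) =ᵐ[volume]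
      fun x => fderiv ℝ (ratio p₀ m v g Q) x (EuclideanSpace.single k 1) := by
    filter_upwards [weakGrad_ae_eq_gradient hC hf] with x hx
    rw [hx, gradient_apply_coord]
  have ht := hg.tame_fderiv_ratio (p₀ := p₀) (m := m) hv Q k
  refine memH1_of_contDiff smoothed_absolutelyContinuous
    (ht.contDiff.of_le (by exact_mod_cast le_top)) hk (ht.memLp 2 (by simp)) ?_
  refine MemLp.of_eval_piLp fun l => ?_
  simp_rw [gradient_apply_coord]
  exact (hg.tame_fderiv_fderiv_ratio hv Q k l).memLp 2 (by simp)

lemma IsBddMeas.generator_ratio_ae_eq (hg : IsBddMeas g M) (hv : 0 < v)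
    (Q : MvPolynomial (Fin d) ℝ) {f : E d → ℝ} (hf : f =ᵐ[volume] ratio p₀ m v g Q) :
    (fun x => weakLaplacian f x + ⟪weakGrad f x,
        gradient (fun y => Real.log (smoothing p₀ m v (fun _ => 1) 1 y)) x⟫_ℝ)
      =ᵐ[volume] generator (smoothing p₀ m v (fun _ => 1) 1) (ratio p₀ m v g Q) := by
  have hC := (hg.contDiff_ratio (p₀ := p₀) (m := m) hv Q).of_le
    (m := 1) (by exact_mod_cast le_top)
  have h1 := weakGrad_ae_eq_gradient hC hf
  have hk : ∀ k : Fin d, (fun x => weakGrad f x k) =ᵐ[volume]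
      fun x => fderiv ℝ (ratio p₀ m v g Q) x (EuclideanSpace.single k 1) := fun k => by
    filter_upwards [h1] with x hx
    rw [hx, gradient_apply_coord]
  have h2 : ∀ᵐ x : E d, ∀ k, weakGrad (fun y => weakGrad f y k) x
      = gradient (fun y => fderiv ℝ (ratio p₀ m v g Q) y (EuclideanSpace.single k 1)) x :=
    ae_all_iff.2 fun k => weakGrad_ae_eq_gradient
      ((hg.tame_fderiv_ratio hv Q k).contDiff.of_le (by exact_mod_cast le_top)) (hk k)
  filter_upwards [h1, h2] with x hx1 hx2
  simp only [weakLaplacian, generator, hx1, hx2, gradient_apply_coord]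

end Ratio

/-! ### Matching the marginals with smoothings; the bound on the weight. -/

section Identification

variable {d : ℕ} {p₀ : Measure (E d)}

lemma gaussianDensity_eq_gaussPoly (m v : ℝ) (x₀ x : E d) :
    gaussianDensity (m • x₀) v x = gaussPoly v 1 (x - m • x₀) := by
  simp [gaussPoly, gaussianDensity]

lemma marginalDensity_eq_smoothing (s : ℝ) : marginalDensity p₀ s
    = smoothing p₀ (meanCoeff s) (varCoeff s) (fun _ => 1) 1 := by
  ext x
  simp only [marginalDensity, smoothing, one_mul, gaussianDensity_eq_gaussPoly]

lemma marginal_eq_smoothed (s : ℝ) :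
    marginal p₀ s = smoothed p₀ (meanCoeff s) (varCoeff s) := by
  rw [marginal, smoothed, marginalDensity_eq_smoothing]

/-- The complement of the support is null for the tilted measure, so `w` vanishes `p₀`-almost
everywhere there, and `0 ≤ b` covers that case. -/
lemma ae_le_of_support_tilted {w : E d → ℝ} (hw : Measurable w) (hw0 : ∀ x, 0 ≤ w x)
    (hZ : 0 < ∫ x, w x ∂p₀) {b : ℝ} (hb : 0 ≤ b) (hwb : ∀ x ∈ (tilted p₀ w).support, w x ≤ b) :
    ∀ᵐ x ∂p₀, w x ≤ b := by
  have h : ∀ᵐ x ∂tilted p₀ w, x ∈ (tilted p₀ w).support := Measure.support_mem_ae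
  rw [tilted, ae_withDensity_iff (hw.div_const _).ennreal_ofReal] at h
  filter_upwards [h] with x hx
  by_cases hwx : w x = 0
  · rw [hwx]; exact hb
  · refine hwb x (hx ?_)
    have : 0 < w x := lt_of_le_of_ne (hw0 x) (Ne.symm hwx)
    simpa using div_pos this hZ

end Identification

/-! ### Doob's function as a quotient of smoothings. -/

section JointLaw

variable {d : ℕ} {Ω : Type*} [MeasurableSpace Ω] {P : Measure Ω} [IsProbabilityMeasure P]
  {p₀ : Measure (E d)} [IsProbabilityMeasure p₀] {T s : ℝ} {X : ℝ → Ω → E d}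

lemma measurable_transition (m v : ℝ) : Measurable fun z : E d × E d =>
    ENNReal.ofReal (gaussianDensity (m • z.1) v z.2) := by
  unfold gaussianDensity; fun_prop

lemma lintegral_gaussianDensity {m v : ℝ} (hv : 0 < v) (x : E d) :
    ∫⁻ x₀, ENNReal.ofReal (gaussianDensity (m • x₀) v x) ∂p₀
      = ENNReal.ofReal (smoothing p₀ m v (fun _ => 1) 1 x) := by
  simp_rw [smoothing, one_mul, ← gaussianDensity_eq_gaussPoly]
  refine (ofReal_integral_eq_lintegral_ofReal ?_ ?_).symm
  · simpa only [one_mul, ← gaussianDensity_eq_gaussPoly] using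
      isBddMeas_one.integrable_mul_gaussPoly (p₀ := p₀) (m := m) hv 1 x
  · exact Eventually.of_forall fun x₀ => (gaussianDensity_pos hv (m • x₀) x).le

lemma IsForwardOU.map_eq_smoothed (hX : IsForwardOU P p₀ T X) (hs : 0 < s) (hsT : s ≤ T) :
    P.map (X s) = smoothed p₀ (meanCoeff s) (varCoeff s) := by
  have h0 : Measurable (X 0) := hX.measurable 0 ⟨le_rfl, hs.le.trans hsT⟩
  have hXs : Measurable (X s) := hX.measurable s ⟨hs.le, hsT⟩
  have hv := varCoeff_pos hs
  have e : P.map (X s) = (P.map fun ω => (X 0 ω, X s ω)).map Prod.snd :=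
    (Measure.map_map measurable_snd (h0.prodMk hXs)).symm
  have hdm := measurable_transition (d := d) (meanCoeff s) (varCoeff s)
  rw [e, hX.map_prodMk hs hsT]
  ext A hA
  have hA2 : MeasurableSet (Prod.snd ⁻¹' A : Set (E d × E d)) := measurable_snd hA
  rw [Measure.map_apply measurable_snd hA, withDensity_apply _ hA2, smoothed,
    withDensity_apply _ hA, ← Set.univ_prod, ← Measure.prod_restrict, Measure.restrict_univ,
    lintegral_prod_symm _ hdm.aemeasurable]
  exact lintegral_congr fun x => lintegral_gaussianDensity hv x

/-- Bayes' formula in weak form: after Fubini the inner integral over `x₀` is the numerator of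
`ratio`, and the marginal density supplies the denominator. -/
lemma IsForwardOU.integral_mul_eq (hX : IsForwardOU P p₀ T X) (hs : 0 < s) (hsT : s ≤ T)
    {W : E d → ℝ} {M : ℝ} (hW : IsBddMeas W M) {φ : E d → ℝ}
    (hφ : Integrable φ (smoothed p₀ (meanCoeff s) (varCoeff s))) :
    ∫ ω, φ (X s ω) * W (X 0 ω) ∂P
      = ∫ x, φ x * ratio p₀ (meanCoeff s) (varCoeff s) W 1 x
          ∂smoothed p₀ (meanCoeff s) (varCoeff s) := by
  have h0 : Measurable (X 0) := hX.measurable 0 ⟨le_rfl, hs.le.trans hsT⟩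
  have hXs : Measurable (X s) := hX.measurable s ⟨hs.le, hsT⟩
  have hv := varCoeff_pos hs
  have hlaw := hX.map_prodMk hs hsT
  have hdm := measurable_transition (d := d) (meanCoeff s) (varCoeff s)
  have hsnd : (P.map fun ω => (X 0 ω, X s ω)).map Prod.snd
      = smoothed p₀ (meanCoeff s) (varCoeff s) := by
    rw [Measure.map_map measurable_snd (h0.prodMk hXs), ← hX.map_eq_smoothed hs hsT]; rfl
  have hφ2 : Integrable (fun z : E d × E d => φ z.2) (P.map fun ω => (X 0 ω, X s ω)) := by
    rw [← hsnd] at hφ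
    exact hφ.comp_measurable measurable_snd
  have hF : Integrable (fun z : E d × E d => φ z.2 * W z.1) (P.map fun ω => (X 0 ω, X s ω)) :=
    hφ2.mul_bdd (c := M) (hW.measurable.comp measurable_fst).aestronglyMeasurable
      (Eventually.of_forall fun z => hW.abs_le _)
  have e1 : ∫ ω, φ (X s ω) * W (X 0 ω) ∂P
      = ∫ z, φ z.2 * W z.1 ∂(P.map fun ω => (X 0 ω, X s ω)) :=
    (integral_map (h0.prodMk hXs).aemeasurable hF.aestronglyMeasurable).symm
  have hfin : ∀ᵐ z ∂(p₀.prod (volume : Measure (E d))),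
      ENNReal.ofReal (gaussianDensity (meanCoeff s • z.1) (varCoeff s) z.2) < ∞ :=
    Eventually.of_forall fun z => ENNReal.ofReal_lt_top
  rw [e1, hlaw, integral_withDensity_eq_integral_toReal_smul hdm hfin]
  rw [hlaw, integrable_withDensity_iff_integrable_smul' hdm hfin] at hF
  rw [integral_prod_symm _ hF, smoothed, integral_withDensity_ofReal
    (isBddMeas_one.contDiff_smoothing hv 1).continuous (smoothing_one_pos hv)]
  refine integral_congr_ae (Eventually.of_forall fun x => ?_)
  simp only [smul_eq_mul]
  have h1 := (smoothing_one_pos (p₀ := p₀) (m := meanCoeff s) hv x).ne'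
  have e2 : smoothing p₀ (meanCoeff s) (varCoeff s) (fun _ => 1) 1 x
      * (φ x * ratio p₀ (meanCoeff s) (varCoeff s) W 1 x)
      = φ x * smoothing p₀ (meanCoeff s) (varCoeff s) W 1 x := by
    rw [ratio]; field_simp
  rw [e2, smoothing, ← integral_const_mul]
  refine integral_congr_ae (Eventually.of_forall fun x₀ => ?_)
  simp only [ENNReal.toReal_ofReal (gaussianDensity_pos hv _ _).le]
  rw [gaussianDensity_eq_gaussPoly]
  ring

/-- Both sides, composed with `X s`, are versions of the same conditional expectation. The equality
passes to the law of `X s`, then to Lebesgue measure by positivity of the density. -/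
lemma IsForwardOU.integral_condDistrib_ae_eq (hX : IsForwardOU P p₀ T X) (hs : 0 < s)
    (hsT : s ≤ T) {w W : E d → ℝ} (hw : Measurable w) {M : ℝ} (hW : IsBddMeas W M)
    (hwW : w =ᵐ[p₀] W) :
    (fun x => ∫ y, w y ∂(condDistrib (X 0) (X s) P x))
      =ᵐ[volume] ratio p₀ (meanCoeff s) (varCoeff s) W 1 := by
  have h0 : Measurable (X 0) := hX.measurable 0 ⟨le_rfl, hs.le.trans hsT⟩
  have hXs : Measurable (X s) := hX.measurable s ⟨hs.le, hsT⟩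
  have hv := varCoeff_pos hs
  have hwW' : (fun ω => w (X 0 ω)) =ᵐ[P] fun ω => W (X 0 ω) := by
    rw [← hX.map_zero] at hwW
    exact ae_of_ae_map h0.aemeasurable hwW
  have hint : Integrable (fun ω => w (X 0 ω)) P := by
    refine Integrable.congr ?_ hwW'.symm
    exact (integrable_const M).mono' (hW.measurable.comp h0).aestronglyMeasurable
      (Eventually.of_forall fun ω => hW.abs_le _)
  have hrc := (hW.contDiff_ratio (p₀ := p₀) (m := meanCoeff s) hv 1).continuous
  have hri : Integrable (ratio p₀ (meanCoeff s) (varCoeff s) W 1)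
      (smoothed p₀ (meanCoeff s) (varCoeff s)) := hW.integrable_ratio hv 1
  have hmap := hX.map_eq_smoothed hs hsT
  have hri' : Integrable (fun ω => ratio p₀ (meanCoeff s) (varCoeff s) W 1 (X s ω)) P := by
    rw [← hmap] at hri
    exact hri.comp_measurable hXs
  have h1 := condExp_ae_eq_integral_condDistrib (μ := P) hXs h0.aemeasurable
    hw.stronglyMeasurable hint
  have h2 : (fun ω => ratio p₀ (meanCoeff s) (varCoeff s) W 1 (X s ω))
      =ᵐ[P] P[fun ω => w (X 0 ω) | MeasurableSpace.comap (X s) inferInstance] := by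
    refine ae_eq_condExp_of_forall_setIntegral_eq hXs.comap_le hint
      (fun A _ _ => hri'.integrableOn) ?_ ?_
    · rintro A ⟨A', hA', rfl⟩ -
      have hA : MeasurableSet (X s ⁻¹' A') := hXs hA'
      rw [integral_congr_ae (ae_restrict_of_ae hwW'), ← integral_indicator hA,
        ← integral_indicator hA]
      have e : ∀ f : Ω → ℝ, (X s ⁻¹' A').indicator f
          = fun ω => A'.indicator (fun _ => (1 : ℝ)) (X s ω) * f ω := by
        intro f
        ext ω
        by_cases h : X s ω ∈ A' <;> simp [Set.indicator, h]
      rw [e, e]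
      have := isFiniteMeasure_smoothed (p₀ := p₀) (m := meanCoeff s) hv
      rw [hX.integral_mul_eq hs hsT hW ((integrable_const (1 : ℝ)).indicator hA'), ← hmap,
        integral_map hXs.aemeasurable]
      exact ((measurable_const.indicator hA').mul hrc.measurable).aestronglyMeasurable
    · exact ((hrc.measurable.comp (comap_measurable (X s)))).aestronglyMeasurable
  have h3 : ∀ᵐ ω ∂P, ∫ y, w y ∂(condDistrib (X 0) (X s) P (X s ω))
      = ratio p₀ (meanCoeff s) (varCoeff s) W 1 (X s ω) := (h2.trans h1).symm
  have hm : Measurable fun x => ∫ y, w y ∂(condDistrib (X 0) (X s) P x) :=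
    (StronglyMeasurable.integral_condDistrib (f := fun z : E d × E d => w z.2)
      (hw.comp measurable_snd).stronglyMeasurable).measurable
  have h4 := (ae_map_iff hXs.aemeasurable (measurableSet_eq_fun hm hrc.measurable)).2 h3
  rw [hmap] at h4
  exact (volume_absolutelyContinuous_smoothed hv).ae_le h4

end JointLaw

/-! ### Euler–Lagrange equation and error bounds. -/

section Variational

variable {d : ℕ} {Ω : Type*} [MeasurableSpace Ω] {P : Measure Ω}
  {Y : ℝ → Ω → E d} {w : E d → ℝ} {T t lam : ℝ} {ν : Measure (E d)} {H g : E d → ℝ}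

/-- If `b ≠ 0`, the choice `ε = -b/(|c|+1)` makes the expression negative, whatever the sign of `c`.
-/
lemma eq_zero_of_quadratic_nonneg {b c : ℝ} (h : ∀ ε : ℝ, 0 ≤ ε * b + ε ^ 2 * c) : b = 0 := by
  by_contra hb
  have hc : 0 < |c| + 1 := by positivity
  have h1 := h (-b / (|c| + 1))
  have h2 : -b / (|c| + 1) * b + (-b / (|c| + 1)) ^ 2 * c
      = -(b ^ 2 / (|c| + 1) ^ 2) * (|c| + 1 - c) := by field_simp; ring
  rw [h2] at h1
  have h3 : 0 < b ^ 2 / (|c| + 1) ^ 2 := by positivity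
  have h4 : 0 < |c| + 1 - c := by linarith [le_abs_self c]
  nlinarith [mul_pos h3 h4]

lemma integral_add_mul_add_mul {α : Type*} [MeasurableSpace α] {μ : Measure α} {f₀ f₁ f₂ : α → ℝ}
    (h₀ : Integrable f₀ μ) (h₁ : Integrable f₁ μ) (h₂ : Integrable f₂ μ) (a b : ℝ) :
    ∫ x, (f₀ x + a * f₁ x + b * f₂ x) ∂μ
      = ∫ x, f₀ x ∂μ + a * ∫ x, f₁ x ∂μ + b * ∫ x, f₂ x ∂μ := by
  have h : Integrable (fun x => f₀ x + a * f₁ x) μ := h₀.add (h₁.const_mul a)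
  rw [integral_add h (h₂.const_mul b), integral_add h₀ (h₁.const_mul a), integral_const_mul,
    integral_const_mul]

lemma memLp_inner_integrable {α F : Type*} [MeasurableSpace α] {μ : Measure α}
    [NormedAddCommGroup F] [InnerProductSpace ℝ F] {f g : α → F}
    (hf : MemLp f 2 μ) (hg : MemLp g 2 μ) : Integrable (fun x => ⟪f x, g x⟫_ℝ) μ := by
  refine (memLp_two_integrable_mul hf.norm hg.norm).mono'
    (hf.aestronglyMeasurable.inner hg.aestronglyMeasurable) (Eventually.of_forall fun x => ?_)
  exact norm_inner_le_norm _ _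

/-- Along `H + ε g` the objective is exactly quadratic in `ε`, so minimality forces the linear
coefficient to vanish without any differentiation. -/
lemma IsRegMinimizer.first_order (hY : Measurable (Y t)) (hν : P.map (Y t) = ν)
    (hac : ν ≪ volume) (hw : MemLp (fun ω => w (Y T ω)) 2 P)
    (hmin : IsRegMinimizer P Y w T t lam ν H) (hg : MemH1 ν g) :
    ∫ ω, (H (Y t ω) - w (Y T ω)) * g (Y t ω) ∂P
      + lam * ∫ ω, ⟪weakGrad H (Y t ω), weakGrad g (Y t ω)⟫_ℝ ∂P = 0 := by
  have hpull : ∀ {F : Type} [NormedAddCommGroup F] {f : E d → F}, MemLp f 2 ν →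
      MemLp (fun ω => f (Y t ω)) 2 P := by
    intro F _ f hf
    rw [← hν] at hf
    exact hf.comp_of_map hY.aemeasurable
  have hH := hmin.1
  have a1 := (hpull hH.memLp).sub hw
  have a2 := hpull hg.memLp
  have a3 := hpull hH.memLp_weakGrad
  have a4 := hpull hg.memLp_weakGrad
  have i1 := memLp_two_integrable_mul a1 a1
  have i2 := memLp_two_integrable_mul a1 a2
  have i3 := memLp_two_integrable_mul a2 a2
  have j1 := memLp_inner_integrable a3 a3
  have j2 := memLp_inner_integrable a3 a4
  have j3 := memLp_inner_integrable a4 a4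
  simp only [Pi.sub_apply] at i1 i2
  have key : ∀ ε : ℝ, regObjective P Y w T t lam (fun x => H x + ε * g x)
      = regObjective P Y w T t lam H
        + ε * (2 * (∫ ω, (H (Y t ω) - w (Y T ω)) * g (Y t ω) ∂P
          + lam * ∫ ω, ⟪weakGrad H (Y t ω), weakGrad g (Y t ω)⟫_ℝ ∂P))
        + ε ^ 2 * (∫ ω, g (Y t ω) * g (Y t ω) ∂P
          + lam * ∫ ω, ⟪weakGrad g (Y t ω), weakGrad g (Y t ω)⟫_ℝ ∂P) := by
    intro ε
    have e1 : objective P Y w T t (fun x => H x + ε * g x) = objective P Y w T t H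
        + (2 * ε) * (∫ ω, (H (Y t ω) - w (Y T ω)) * g (Y t ω) ∂P)
        + ε ^ 2 * ∫ ω, g (Y t ω) * g (Y t ω) ∂P := by
      have e : ∀ ω, (H (Y t ω) + ε * g (Y t ω) - w (Y T ω)) ^ 2
          = (H (Y t ω) - w (Y T ω)) * (H (Y t ω) - w (Y T ω))
            + (2 * ε) * ((H (Y t ω) - w (Y T ω)) * g (Y t ω))
            + ε ^ 2 * (g (Y t ω) * g (Y t ω)) := fun ω => by ring
      simp_rw [objective, e, sq (H _ - _)]
      exact integral_add_mul_add_mul i1 i2 i3 _ _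
    -- `weakGrad` is linear only up to Lebesgue-null sets, and these are null for the law `ν` of `Y
    -- t`.
    have hgrad : ∀ᵐ ω ∂P, weakGrad (fun x => H x + ε * g x) (Y t ω)
        = weakGrad H (Y t ω) + ε • weakGrad g (Y t ω) := by
      have := hac.ae_le (hH.weakGrad_add_smul hg ε)
      rw [← hν] at this
      exact ae_of_ae_map hY.aemeasurable this
    have e2 : ∫ ω, ‖weakGrad (fun x => H x + ε * g x) (Y t ω)‖ ^ 2 ∂P
        = ∫ ω, ‖weakGrad H (Y t ω)‖ ^ 2 ∂P
          + (2 * ε) * (∫ ω, ⟪weakGrad H (Y t ω), weakGrad g (Y t ω)⟫_ℝ ∂P)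
          + ε ^ 2 * ∫ ω, ⟪weakGrad g (Y t ω), weakGrad g (Y t ω)⟫_ℝ ∂P := by
      have e : ∀ᵐ ω ∂P, ‖weakGrad (fun x => H x + ε * g x) (Y t ω)‖ ^ 2
          = ⟪weakGrad H (Y t ω), weakGrad H (Y t ω)⟫_ℝ
            + (2 * ε) * ⟪weakGrad H (Y t ω), weakGrad g (Y t ω)⟫_ℝ
            + ε ^ 2 * ⟪weakGrad g (Y t ω), weakGrad g (Y t ω)⟫_ℝ := by
        filter_upwards [hgrad] with ω hω
        rw [hω, norm_add_sq_real, inner_smul_right, norm_smul, mul_pow,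
          real_inner_self_eq_norm_sq, real_inner_self_eq_norm_sq, Real.norm_eq_abs, sq_abs]
        ring
      rw [integral_congr_ae e, integral_add_mul_add_mul j1 j2 j3]
      simp_rw [real_inner_self_eq_norm_sq]
    rw [regObjective, regObjective, e1, e2]
    ring
  have h2 := eq_zero_of_quadratic_nonneg (fun ε => by
    have := hmin.2 _ (hH.add_smul hac hg ε)
    rw [key ε] at this
    linarith : ∀ ε : ℝ, 0 ≤ ε * (2 * (∫ ω, (H (Y t ω) - w (Y T ω)) * g (Y t ω) ∂P
          + lam * ∫ ω, ⟪weakGrad H (Y t ω), weakGrad g (Y t ω)⟫_ℝ ∂P))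
        + ε ^ 2 * (∫ ω, g (Y t ω) * g (Y t ω) ∂P
          + lam * ∫ ω, ⟪weakGrad g (Y t ω), weakGrad g (Y t ω)⟫_ℝ ∂P))
  linarith

lemma eLpNorm_two_sq {α F : Type*} [MeasurableSpace α] {μ : Measure α} [NormedAddCommGroup F]
    {f : α → F} (hf : MemLp f 2 μ) :
    eLpNorm f 2 μ ^ 2 = ENNReal.ofReal (∫ x, ‖f x‖ ^ 2 ∂μ) := by
  have h0 : 0 ≤ ∫ x, ‖f x‖ ^ 2 ∂μ := integral_nonneg fun x => by positivity
  rw [hf.eLpNorm_eq_integral_rpow_norm (by simp) (by simp),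
    ← ENNReal.ofReal_pow (Real.rpow_nonneg (integral_nonneg fun x => by positivity) _)]
  congr 1
  simp only [ENNReal.toReal_ofNat, Real.rpow_ofNat]
  rw [← Real.rpow_natCast, ← Real.rpow_mul h0]
  norm_num

/-- The error bounds that follow from the Euler–Lagrange equation. -/
lemma error_bounds_of_first_order {G : E d → E d} {R : E d → ℝ} (hlam : 0 < lam)
    (hg : MemLp g 2 ν) (hG : MemLp G 2 ν) (hR : MemLp R 2 ν)
    (h : ∫ x, g x * g x ∂ν + lam * ∫ x, ‖G x‖ ^ 2 ∂ν = lam * ∫ x, g x * R x ∂ν) :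
    eLpNorm g 2 ν ^ 2 ≤ ENNReal.ofReal (lam ^ 2) * eLpNorm R 2 ν ^ 2 ∧
      eLpNorm G 2 ν ^ 2 ≤ ENNReal.ofReal lam * eLpNorm R 2 ν ^ 2 := by
  have i1 := memLp_two_integrable_mul hg hg
  have i2 := memLp_two_integrable_mul hg hR
  have i3 := memLp_two_integrable_mul hR hR
  have hB : 0 ≤ ∫ x, ‖G x‖ ^ 2 ∂ν := integral_nonneg fun x => by positivity
  have hC : 0 ≤ ∫ x, R x * R x ∂ν := integral_nonneg fun x => mul_self_nonneg _
  have hA : 0 ≤ ∫ x, g x * g x ∂ν := integral_nonneg fun x => mul_self_nonneg _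
  have hsq : 0 ≤ ∫ x, (g x * g x + (-(2 * lam)) * (g x * R x) + lam ^ 2 * (R x * R x)) ∂ν :=
    integral_nonneg fun x => by
      have : g x * g x + (-(2 * lam)) * (g x * R x) + lam ^ 2 * (R x * R x)
        = (g x - lam * R x) ^ 2 := by ring
      simp only [this, Pi.zero_apply]
      positivity
  rw [integral_add_mul_add_mul i1 i2 i3] at hsq
  have e1 : ∫ x, ‖g x‖ ^ 2 ∂ν = ∫ x, g x * g x ∂ν :=
    integral_congr_ae (Eventually.of_forall fun x => by simp [← sq])
  have e2 : ∫ x, ‖R x‖ ^ 2 ∂ν = ∫ x, R x * R x ∂ν :=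
    integral_congr_ae (Eventually.of_forall fun x => by simp [← sq])
  rw [eLpNorm_two_sq hg, eLpNorm_two_sq hG, eLpNorm_two_sq hR, e1, e2,
    ← ENNReal.ofReal_mul (by positivity), ← ENNReal.ofReal_mul hlam.le]
  have hBl : 0 ≤ lam * ∫ x, ‖G x‖ ^ 2 ∂ν := mul_nonneg hlam.le hB
  -- The square `∫ (g - lam R)² ≥ 0` and `h` combine to `‖g‖² + 2 lam ‖G‖² ≤ lam² ‖R‖²`. Dropping
  -- either term on the left gives one of the bounds, the second with a factor `1/2` to spare.
  constructor
  · exact ENNReal.ofReal_le_ofReal (by nlinarith)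
  · refine ENNReal.ofReal_le_ofReal ?_
    have h1 : lam * (2 * ∫ x, ‖G x‖ ^ 2 ∂ν) ≤ lam * (lam * ∫ x, R x * R x ∂ν) := by nlinarith
    have := le_of_mul_le_mul_left h1 hlam
    linarith

end Variational

end DoobMatching

/-! ### The main theorem. -/

open DoobMatching

theorem mainTheorem5 {d : ℕ} {Ω : Type*} [MeasurableSpace Ω]
    (P : Measure Ω) [IsProbabilityMeasure P]
    (p₀ : Measure (DoobMatching.E d)) [IsProbabilityMeasure p₀]
    (w : DoobMatching.E d → ℝ) (hw_meas : Measurable w) (hw_nonneg : ∀ x, 0 ≤ w x)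
    (hw_int : Integrable w p₀) (hZ : 0 < ∫ x, w x ∂p₀)
    -- the support of the tilted distribution lies in the cube
    (h_supp : (DoobMatching.tilted p₀ w).support ⊆ {x | ∀ i : Fin d, |x i| ≤ 1})
    -- the weight is bounded above and away from zero on that support
    (Blow Bup : ℝ) (hBlow_pos : 0 < Blow) (hBlow_lt : Blow < 1) (hBup : 1 < Bup)
    (hw_bdd : ∀ x ∈ (DoobMatching.tilted p₀ w).support, Blow ≤ w x ∧ w x ≤ Bup)
    (T t : ℝ) (ht : 0 < t) (htT : t < T)
    (X : ℝ → Ω → DoobMatching.E d) (hX : DoobMatching.IsForwardOU P p₀ T X) :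
    let hstar : DoobMatching.E d → ℝ :=
      DoobMatching.doobH P (DoobMatching.timeReversal T X) w T t
    let ν : Measure (DoobMatching.E d) := DoobMatching.marginal p₀ (T - t)
    let R : DoobMatching.E d → ℝ := fun x =>
      DoobMatching.weakLaplacian hstar x
        + ⟪DoobMatching.weakGrad hstar x, DoobMatching.score p₀ (T - t) x⟫_ℝ
    DoobMatching.MemH2 ν hstar ∧
    MemLp R 2 ν ∧
    ∀ lam : ℝ, 0 < lam → ∀ hlam : DoobMatching.E d → ℝ,
      DoobMatching.IsRegMinimizer P (DoobMatching.timeReversal T X) w T t lam ν hlam →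
        eLpNorm (fun x => hlam x - hstar x) 2 ν ^ 2
          ≤ ENNReal.ofReal (lam ^ 2) * eLpNorm R 2 ν ^ 2 ∧
        eLpNorm (fun x => DoobMatching.weakGrad hlam x - DoobMatching.weakGrad hstar x) 2 ν ^ 2
          ≤ ENNReal.ofReal lam * eLpNorm R 2 ν ^ 2 := by
  intro hstar ν R
  have hs : 0 < T - t := by linarith
  have hsT : T - t ≤ T := by linarith
  have hT : timeReversal T X T = X 0 := by simp [timeReversal]
  have hv := varCoeff_pos hs
  have h0 : Measurable (X 0) := hX.measurable 0 ⟨le_rfl, by linarith⟩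
  have hXs : Measurable (X (T - t)) := hX.measurable (T - t) ⟨hs.le, hsT⟩
  have hwb := ae_le_of_support_tilted hw_meas hw_nonneg hZ (b := Bup) (by linarith)
    fun x hx => (hw_bdd x hx).2
  -- `w` is bounded only `p₀`-almost everywhere; the truncation `W` is bounded everywhere and agrees
  -- with it `p₀`-almost everywhere.
  set W : E d → ℝ := fun x => min (w x) Bup
  have hW : IsBddMeas W Bup := by
    refine ⟨hw_meas.min measurable_const, fun x => ?_⟩
    rw [abs_of_nonneg (le_min (hw_nonneg x) (by linarith))]
    exact min_le_right _ _
  have hwW : w =ᵐ[p₀] W := by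
    filter_upwards [hwb] with x hx
    exact (min_eq_left hx).symm
  have hν : ν = smoothed p₀ (meanCoeff (T - t))
      (varCoeff (T - t)) := marginal_eq_smoothed _
  have hlaw : P.map (X (T - t)) = ν := by rw [hν]; exact hX.map_eq_smoothed hs hsT
  have hac : ν ≪ volume := by rw [hν]; exact smoothed_absolutelyContinuous
  set u := ratio p₀ (meanCoeff (T - t))
    (varCoeff (T - t)) W 1 with hu
  have hstar_eq : hstar =ᵐ[volume] u := by
    have e : hstar = fun x => ∫ y, w y ∂(condDistrib (X 0) (X (T - t)) P x) := by
      rw [← hT]; rfl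
    rw [e]
    exact hX.integral_condDistrib_ae_eq hs hsT hw_meas hW hwW
  have hH2 : MemH2 ν hstar := by
    rw [hν]; exact hW.memH2_ratio hv 1 hstar_eq
  have hR_eq : R =ᵐ[volume] generator (smoothing p₀
      (meanCoeff (T - t)) (varCoeff (T - t)) (fun _ => 1) 1) u := by
    have := hW.generator_ratio_ae_eq (p₀ := p₀) (m := meanCoeff (T - t)) hv 1 hstar_eq
    simp only [R, score, marginalDensity_eq_smoothing]
    exact this
  have hgen := hW.memLp_generator_ratio (p₀ := p₀) (m := meanCoeff (T - t)) hv 1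
  rw [← hu, ← hν] at hgen
  have hR : MemLp R 2 ν := hgen.ae_eq (hac.ae_eq hR_eq.symm)
  refine ⟨hH2, hR, fun lam hlam H hmin => ?_⟩
  set g : E d → ℝ := fun x => H x + (-1) * hstar x with hg_def
  have hg : MemH1 ν g := hmin.1.add_smul hac hH2.memH1 (-1)
  have hgrad : weakGrad g =ᵐ[volume]
      fun x => weakGrad H x + (-1 : ℝ) • weakGrad hstar x :=
    hmin.1.weakGrad_add_smul hH2.memH1 (-1)
  have hgrad' : weakGrad g =ᵐ[ν]
      fun x => weakGrad H x - weakGrad hstar x := by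
    filter_upwards [hac.ae_le hgrad] with x hx
    rw [hx, neg_one_smul, sub_eq_add_neg]
  have hwW' : (fun ω => w (X 0 ω)) =ᵐ[P] fun ω => W (X 0 ω) := by
    rw [← hX.map_zero] at hwW
    exact ae_of_ae_map h0.aemeasurable hwW
  have hw2 : MemLp (fun ω => w (timeReversal T X T ω)) 2 P := by
    rw [hT]
    exact (MemLp.of_bound (hW.measurable.comp h0).aestronglyMeasurable Bup
      (Filter.Eventually.of_forall fun ω => hW.abs_le _)).ae_eq hwW'.symm
  have hfo := hmin.first_order (Y := timeReversal T X) (t := t) hXs hlaw hac hw2 hg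
  have hgH : ∀ x, g x = H x - hstar x := fun x => by simp only [hg_def]; ring
  have hpull : ∀ {f : E d → ℝ}, MemLp f 2 ν →
      MemLp (fun ω => f (X (T - t) ω)) 2 P := fun hf => by
    rw [← hlaw] at hf
    exact hf.comp_of_map hXs.aemeasurable
  have : IsFiniteMeasure ν := by
    rw [hν]; exact isFiniteMeasure_smoothed hv
  have hHL := hmin.1.memLp
  -- Conditioning on `X_{T-t}` replaces `w(X_0)` by `hstar`, so the residual `H - w` becomes `g`.
  have e1 : ∫ ω, (H (timeReversal T X t ω)
      - w (timeReversal T X T ω)) * g (timeReversal T X t ω) ∂P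
      = ∫ x, g x * g x ∂ν := by
    have hw3 : MemLp (fun ω => w (X 0 ω)) 2 P := by rwa [hT] at hw2
    rw [hT]
    have i1 := memLp_two_integrable_mul (hpull hHL) (hpull hg.memLp)
    have i2 := memLp_two_integrable_mul (hpull hg.memLp) hw3
    have a1 : ∫ ω, (H (timeReversal T X t ω) - w (X 0 ω))
        * g (timeReversal T X t ω) ∂P
        = ∫ ω, H (X (T - t) ω) * g (X (T - t) ω) ∂P - ∫ ω, g (X (T - t) ω) * w (X 0 ω) ∂P := by
      rw [← integral_sub i1 i2]
      refine integral_congr_ae (Filter.Eventually.of_forall fun ω => ?_)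
      simp only [timeReversal]
      ring
    have a2 : ∫ ω, H (X (T - t) ω) * g (X (T - t) ω) ∂P = ∫ x, H x * g x ∂ν := by
      have := (memLp_two_integrable_mul hHL hg.memLp).aestronglyMeasurable
      rw [← hlaw] at this ⊢
      exact (integral_map hXs.aemeasurable this).symm
    have a3 : ∫ ω, g (X (T - t) ω) * w (X 0 ω) ∂P = ∫ x, g x * hstar x ∂ν := by
      have hgi : Integrable g ν := hg.memLp.integrable (by norm_num)
      rw [hν] at hgi
      have h1 : ∫ ω, g (X (T - t) ω) * w (X 0 ω) ∂P = ∫ ω, g (X (T - t) ω) * W (X 0 ω) ∂P := by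
        refine integral_congr_ae ?_
        filter_upwards [hwW'] with ω hω
        rw [hω]
      rw [h1, hX.integral_mul_eq hs hsT hW hgi, ← hν]
      refine integral_congr_ae ?_
      filter_upwards [hac.ae_le hstar_eq] with x hx
      rw [hx]
    rw [a1, a2, a3, ← integral_sub (memLp_two_integrable_mul hHL hg.memLp)
      (memLp_two_integrable_mul hg.memLp hH2.memH1.memLp)]
    refine integral_congr_ae (Filter.Eventually.of_forall fun x => ?_)
    simp only [hgH]
    ring
  have hu1 := hW.memLp_gradient_ratio (p₀ := p₀) (m := meanCoeff (T - t)) hv 1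
  rw [← hu, ← hν] at hu1
  -- Here `∇H = ∇g + ∇hstar`, and the cross term `∫ ∇g·∇hstar` equals `-∫ g R` by the symmetry of
  -- the generator, applied to the smooth representative `u`.
  have e2 : ∫ ω, ⟪weakGrad H (timeReversal T X t ω),
      weakGrad g (timeReversal T X t ω)⟫_ℝ ∂P
      = ∫ x, ‖weakGrad H x - weakGrad hstar x‖ ^ 2 ∂ν
        - ∫ x, g x * R x ∂ν := by
    have a1 : ∫ ω, ⟪weakGrad H (timeReversal T X t ω),
        weakGrad g (timeReversal T X t ω)⟫_ℝ ∂P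
        = ∫ x, ⟪weakGrad H x, weakGrad g x⟫_ℝ ∂ν := by
      have := (memLp_inner_integrable hmin.1.memLp_weakGrad
        hg.memLp_weakGrad).aestronglyMeasurable
      rw [← hlaw] at this ⊢
      exact (integral_map hXs.aemeasurable this).symm
    have hu_grad : weakGrad hstar =ᵐ[ν] gradient u :=
      hac.ae_eq (weakGrad_ae_eq_gradient
        ((hW.contDiff_ratio hv 1).of_le (by exact_mod_cast le_top)) hstar_eq)
    have a2 : ∫ x, ⟪weakGrad H x, weakGrad g x⟫_ℝ ∂ν
        = ∫ x, (‖weakGrad H x - weakGrad hstar x‖ ^ 2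
          + ⟪weakGrad g x, gradient u x⟫_ℝ) ∂ν := by
      refine integral_congr_ae ?_
      filter_upwards [hgrad', hu_grad] with x hx1 hx2
      rw [hx1, ← hx2, real_inner_comm, ← real_inner_self_eq_norm_sq, ← inner_add_right,
        sub_add_cancel]
    have hdiff := (hmin.1.memLp_weakGrad.sub hH2.memH1.memLp_weakGrad)
    have a3 := integral_inner_weakGrad_gradient
      (isBddMeas_one.contDiff_smoothing (p₀ := p₀)
        (m := meanCoeff (T - t)) hv 1)
      (smoothing_one_pos hv) (hW.contDiff_ratio (p₀ := p₀)
        (m := meanCoeff (T - t)) hv 1)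
      (by rw [hν] at hg; exact hg) (by rw [hν] at hu1; exact hu1) (by rw [hν] at hgen; exact hgen)
    have a4 : ∫ x, ⟪weakGrad g x, gradient u x⟫_ℝ ∂ν = - ∫ x, g x * R x ∂ν := by
      have h1 : ∫ x, g x * R x ∂ν = ∫ x, g x * generator (smoothing p₀
          (meanCoeff (T - t)) (varCoeff (T - t)) (fun _ => 1) 1) u x
          ∂ν := by
        refine integral_congr_ae ?_
        filter_upwards [hac.ae_le hR_eq] with x hx
        rw [hx]
      rw [h1, hν]
      exact a3
    have hdiff_int : Integrable
        (fun x => ‖weakGrad H x - weakGrad hstar x‖ ^ 2) ν :=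
      hdiff.norm.integrable_sq
    rw [a1, a2, integral_add hdiff_int
      (memLp_inner_integrable hg.memLp_weakGrad hu1), a4, sub_eq_add_neg]
  rw [e1, e2] at hfo
  have hfin := error_bounds_of_first_order hlam hg.memLp
    (hmin.1.memLp_weakGrad.sub hH2.memH1.memLp_weakGrad) hR (by
      simp only [Pi.sub_apply]
      linarith)
  have hg_eq : g = fun x => H x - hstar x := funext hgH
  rw [hg_eq] at hfin
  exact hfin
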